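/- **Notation.** For real $X$ put $[X]:=\{1,\dots,\lfloor X\rfloor\}$; $\mathbb{E}_{x\in S}$ is the average over the finite set $S$. A polynomial $P=a_dy^d+\dots+a_1y\in\mathbb{Z}[y]$ of degree $d\ge 1$ (with zero constant term) has *$(C,q)$-coefficients* if $|a_i|\le C|a_d|$ for $1\le i\le d-1$ and $a_d=a_d'q^{d-1}$ with $0<|a_d'|\le C$. Set $$\Lambda^{N,M}_{P_1,\dots,P_\ell}(f_0,\dots,f_\ell):=\frac1{NM}\sum_{x\in\mathbb{Z}}\sum_{y\in[M]}f_0(x)f_1(x+P_1(y))\cdots f_\ell(x+P_\ell(y)).$$ For finite nonempty $Q_1,\dots,Q_d\subset\mathbb{Z}$ ($d\geq 1$) and $f:\mathbb{Z}\to\mathbb{C}$ supported on a finite nonempty set $S\subset\mathbb{Z}$, the Gowers box norm is the nonnegative real number defined by $$\|f\|^{2^d}_{\square^d_{Q_1,\dots,Q_d}(S)}:=\frac1{|S|}\sum_{x\in\mathbb{Z}}\mathbb{E}_{h_i,h_i'\in Q_i,\ i=1,\dots,d}\ \Delta'_{(h_1,h_1')}\cdots\Delta'_{(h_d,h_d')}f(x),\qquad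 \Delta'_{(h,h')}f(x):=\overline{f(x+h)}f(x+h').$$ **Index sets and directions.** Let $\ell\ge1$ and $c\ne0$ be integers. Define recursively $I_0:=\{0\}$ and, given positive integers $k_i$ for $i\in I_{j-1}$, $$I_j:=\{0,1\}^{\{(i,r):\,i\in I_{j-1},\,r\in[k_i]\}}\setminus\{\underline 0\}\qquad(1\le j\le \ell-1),$$ and integer polynomials $p_i$ ($i\in I_j$) in formal variables $a^{(j')}_{i',r}$ ($1\le j'\le j$, $i'\in I_{j'-1}$, $r\in[k_{i'}]$) by $p_0:=c$ for the single element $0\in I_0$ and $$p_\omega:=\sum_{i\in I_{j-1},\,r\in[k_i]}\omega_{(i,r)}\,(\ell-(j-1))\,p_i\,a^{(j)}_{i,r}\qquad(\omega\in I_j).$$ Write $\mathcal{A}_j=\mathcal{A}_j(\ell,c;(k_i))$ for the family $(p_i)_{i\in I_j}$. **Proposition.** Let $\ell\ge 1$. There are positive integers $K,B_1,B_2$ depending only on $\ell$ and, for every $C>0$, constants $c_1,c_2>0$ depending only on $C$ and $\ell$, such that the following holds. Let $N,M>0$ be real, $q\ge1$ an integer, and let $P_1,\dots,P_\ell\in\mathbb{Z}[y]$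 have $(C,q)$-coefficients with $\deg P_i=i$ for $i=1,\dots,\ell$; let $c_\ell$ be the leading coefficient of $P_\ell$. Then there exist positive integers $k_i\le K$ for each $i\in I_j$, $j=0,\dots,\ell-2$, such that the following holds. If $1/C\le q^{\ell-1}M^\ell/N\le C$, the functions $f_0,\dots,f_\ell:\mathbb{Z}\to\mathbb{C}$ satisfy $|f_i|\le1$ and are supported on $[N]$, $\delta>0$, $$\left|\Lambda^{N,M}_{P_1,\dots,P_\ell}(f_0,\dots,f_\ell)\right|\ge\delta,$$ and $0<\delta'\le c_1\delta^{B_1}$ with $\delta'M\ge1$, then $$\mathbb{E}_{\underline a\in A}\ \|f_\ell\|_{\square^{|I_{\ell-1}|}_{(p(\underline a)[\delta'M])_{p\in\mathcal{A}_{\ell-1}}}([N])}\ \ge\ c_2\,\delta^{B_2},$$ where $\mathcal{A}_{\ell-1}=\mathcal{A}_{\ell-1}(\ell,c_\ell;(k_i))$ and $A:=((-\delta'M,\delta'M)\cap\mathbb{Z})^{\sum_{j=0}^{\ell-2}\sum_{i\in I_j}k_i}$ is the set of values of the tuple $\underline a=(a^{(j)}_{i,r})_{1\le j\le\ell-1,\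 i\in I_{j-1},\ r\in[k_i]}$. -/

import Mathlib

open scoped BigOperators

namespace PolyBox

/-! ### Intervals, polynomials and the multilinear average -/

/-- `[X] = {1, …, ⌊X⌋}` for real `X`, as a finite set of integers (empty for `X < 1`). -/
noncomputable def interval (X : ℝ) : Finset ℤ := Finset.Icc 1 ⌊X⌋

/-- `(-X, X) ∩ ℤ` for real `X`. -/
noncomputable def symmInterval (X : ℝ) : Finset ℤ := Finset.Ioo ⌊-X⌋ ⌈X⌉

theorem mem_interval {X : ℝ} {n : ℤ} : n ∈ interval X ↔ 1 ≤ n ∧ (n : ℝ) ≤ X := by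
  simp [interval, Int.le_floor]

theorem mem_symmInterval {X : ℝ} {n : ℤ} :
    n ∈ symmInterval X ↔ -X < (n : ℝ) ∧ (n : ℝ) < X := by
  simp only [symmInterval, Finset.mem_Ioo, Int.floor_lt, Int.lt_ceil]

/-- The integer polynomial `P = a_d y^d + ⋯ + a_1 y` has `(C, q)`-coefficients:
`|a_i| ≤ C |a_d|` for `1 ≤ i ≤ d - 1`, and `a_d = a' q^(d-1)` with `0 < |a'| ≤ C`. -/
structure HasCoefficients (C : ℝ) (q : ℕ) (P : Polynomial ℤ) : Prop where
  coeff_zero : P.coeff 0 = 0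
  coeff_le : ∀ i : ℕ, 1 ≤ i → i < P.natDegree →
    |(P.coeff i : ℝ)| ≤ C * |(P.leadingCoeff : ℝ)|
  leading : ∃ a' : ℝ, (P.leadingCoeff : ℝ) = a' * (q : ℝ) ^ (P.natDegree - 1) ∧
    0 < |a'| ∧ |a'| ≤ C

/-- The multilinear average
`(1 / (N M)) ∑_{x ∈ ℤ} ∑_{y ∈ [M]} f_0(x) f_1(x + P_1(y)) ⋯ f_ℓ(x + P_ℓ(y))`. -/
noncomputable def multiAverage (ℓ : ℕ) (N M : ℝ) (P : ℕ → Polynomial ℤ)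
    (f : ℕ → ℤ → ℂ) : ℂ :=
  1 / ((N : ℂ) * (M : ℂ)) * ∑' x : ℤ, ∑ y ∈ interval M,
    f 0 x * ∏ i ∈ Finset.Icc 1 ℓ, f i (x + (P i).eval y)

/-! ### Gowers box norms -/

/-- `Δ'_{(h, h')} f (x) = conj (f (x + h)) * f (x + h')`. -/
noncomputable def boxDiff (h : ℤ × ℤ) (f : ℤ → ℂ) : ℤ → ℂ :=
  fun x => (starRingEnd ℂ) (f (x + h.1)) * f (x + h.2)

/-- The operators `Δ'` commute, so that their composition over an unordered finite family
makes sense. -/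
instance boxDiff_leftCommutative : LeftCommutative boxDiff where
  left_comm h k f := by
    funext x
    simp only [boxDiff, map_mul, Complex.conj_conj, add_right_comm x k.1, add_right_comm x k.2]
    ring

/-- `Δ'_{(h_i, h'_i)_{i ∈ ι}} f`, the composition of the operators `Δ'_{(h_i, h'_i)}`. -/
noncomputable def boxDiffs {ι : Type*} [Fintype ι] (h h' : ι → ℤ) (f : ℤ → ℂ) : ℤ → ℂ :=
  ((Finset.univ : Finset ι).val.map (fun i => (h i, h' i))).foldr boxDiff f

/-- The `2^d`-th power of the box norm of `f` with respect to `(Q_i)_{i ∈ ι}`, `d = |ι|`: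
`(1 / |S|) ∑_{x ∈ ℤ} 𝔼_{h_i, h'_i ∈ Q_i} Δ'_{(h_i, h'_i)_{i ∈ ι}} f (x)`. -/
noncomputable def boxNormPow {ι : Type*} [Fintype ι] [DecidableEq ι]
    (Q : ι → Finset ℤ) (S : Finset ℤ) (f : ℤ → ℂ) : ℂ :=
  1 / (S.card : ℂ) * ∑' x : ℤ,
    𝔼 h ∈ Fintype.piFinset Q, 𝔼 h' ∈ Fintype.piFinset Q, boxDiffs h h' f x

/-- The Gowers box norm. For `d ≥ 1` the quantity `boxNormPow Q S f` is real and nonnegative,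
hence equal to its modulus, and the norm is its `2^d`-th root. -/
noncomputable def boxNorm {ι : Type*} [Fintype ι] [DecidableEq ι]
    (Q : ι → Finset ℤ) (S : Finset ℤ) (f : ℤ → ℂ) : ℝ :=
  ‖boxNormPow Q S f‖ ^ (1 / (2 : ℝ) ^ Fintype.card ι)

/-! ### The index sets `I_j` and the direction families `𝒜_j`

An element `ω` of `{0,1}^{(i, r) : i ∈ I_j, r ∈ [k_i]}` is encoded as the set of the pairs
`(i, r)` at which `ω` equals `1`. -/

/-- The ambient type of the indices of level `j`. -/
def Idx : ℕ → Type
  | 0 => Unit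
  | j + 1 => Finset ((_ : Idx j) × ℕ)

instance Idx.decEq : (j : ℕ) → DecidableEq (Idx j)
  | 0 => inferInstanceAs (DecidableEq Unit)
  | j + 1 =>
    haveI := Idx.decEq j
    inferInstanceAs (DecidableEq (Finset ((_ : Idx j) × ℕ)))

/-- The set of the pairs `(i, r)` at which `ω` equals `1`. -/
def Idx.ones {j : ℕ} (ω : Idx (j + 1)) : Finset ((_ : Idx j) × ℕ) := ω

/-- `I_0` is a one-point set and `I_{j+1} = {0,1}^{(i, r) : i ∈ I_j, r ∈ [k_i]} ∖ {0}`. Only the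
values `k j i` with `i ∈ I_j` matter. -/
def indexSet (k : (j : ℕ) → Idx j → ℕ) : (j : ℕ) → Finset (Idx j)
  | 0 => {()}
  | j + 1 => (((indexSet k j).sigma fun i => Finset.Icc 1 (k j i)).powerset).erase ∅

/-- The type of names of variables: `⟨j, i, r⟩` is the name of `a_{i,r}^{(j+1)}`. -/
abbrev Var : Type := (j : ℕ) × (_ : Idx j) × ℕ

/-- The variables `a_{i,r}^{(j+1)}` with `0 ≤ j ≤ ℓ - 2`, `i ∈ I_j`, `r ∈ [k_i]`. -/
def varSet (k : (j : ℕ) → Idx j → ℕ) (ℓ : ℕ) : Finset Var :=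
  (Finset.range (ℓ - 1)).sigma fun j =>
    (indexSet k j).sigma fun i => Finset.Icc 1 (k j i)

/-- The polynomials `p_i` for `i` of level `j`: `p = c` at level `0`, and for `ω` of level `j + 1`
`p_ω = ∑_{(i, r) : ω(i,r) = 1} (ℓ - j) p_i a_{i,r}^{(j+1)}`. The family `𝒜_j` is
`(dirPoly ℓ c j i)_{i ∈ I_j}`. -/
noncomputable def dirPoly (ℓ : ℕ) (c : ℤ) : (j : ℕ) → Idx j → MvPolynomial Var ℤ
  | 0, _ => MvPolynomial.C c
  | j + 1, ω => ∑ v ∈ ω.ones,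
      MvPolynomial.C ((ℓ : ℤ) - j) * dirPoly ℓ c j v.1 * MvPolynomial.X ⟨j, v⟩

/-- The value `p(a)` at a tuple `a` indexed by the variables in `V`. Variables outside `V` are set
to `0`; those do not occur in the polynomials to which this is applied. -/
noncomputable def evalAt (V : Finset Var) (a : V → ℤ) (p : MvPolynomial Var ℤ) : ℤ :=
  MvPolynomial.eval (fun v => if hv : v ∈ V then a ⟨v, hv⟩ else 0) p

/-- The dilate `p · [X]`. -/
noncomputable def dilate (p : ℤ) (X : ℝ) : Finset ℤ := (interval X).image fun h => p * h

/-- The average over `a ∈ A = ((-X, X) ∩ ℤ)^{∑_{j ≤ ℓ-2} ∑_{i ∈ I_j} k_i}` of the box norms of `f`,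
normalised on `[N]`, with directions `(p_i(a)[X])_{i ∈ I_{ℓ-1}}`, where
`(p_i)_{i ∈ I_{ℓ-1}} = 𝒜_{ℓ-1}(ℓ, c; k)`. -/
noncomputable def averageBoxNorm (ℓ : ℕ) (c : ℤ) (k : (j : ℕ) → Idx j → ℕ) (N X : ℝ)
    (f : ℤ → ℂ) : ℝ :=
  𝔼 a ∈ Fintype.piFinset (fun _ : varSet k ℓ => symmInterval X),
    boxNorm
      (fun i : indexSet k (ℓ - 1) =>
        dilate (evalAt (varSet k ℓ) a (dirPoly ℓ c (ℓ - 1) i)) X)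
      (interval N) f

end PolyBox

open PolyBox

/-! The proof is a PET induction (van der Corput differencing, in the style of Peluse) in which the
leading coefficients are followed explicitly.

One van der Corput step: translate `x` so that some factors no longer depend on `y`, apply
Cauchy–Schwarz in `(x, y)` to discard them, and keep two copies of every other factor, one of them
conjugated and shifted by `y ↦ y - a_v` with a fresh parameter `a_v` (`norm_corr_mul_sq_le_expect`,
`avgCorr_sq_le`). Only finitely supported 1-bounded functions enter, so the polynomials can be
treated as formal labels.

A class of factors whose polynomials differ in degree less than `d` is removed in a number of steps
that depends only on `d` and its size (`eliminable`). For `d = 0` the polynomials agree and one step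
suffices. For `d + 1` each factor starts a class of its own; while one class is removed the others
double at each step, but the differences inside a class stay of degree less than `d`, because a
shift does not affect the top coefficient.

In round `j` the factor `s` carrying `f_ℓ` is distinguished, and relative to it the class of `i ∈
I_j` has degree at most `ℓ - j` with top coefficient given by `p_i`. Removing all classes leaves
only the descendants of `s`, one for each set `ω` of level-`j` variables, namely those at which the
shifted copy was taken. Shifting a polynomial `b y^D + ⋯` by `a_v` lowers its coefficient of degree
`D - 1` by `D b a_v`, so the unshifted descendant, which still carries `f_ℓ`, differs from that of
`ω` by degree at most `ℓ - j - 1` with coefficient `∑_{v ∈ ω} (ℓ - j) p_i a_v`, where `i` is the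
index to which `v` belongs. This is the recursion for `p_ω`, and `IsRound.next` is the passage from
`j` to `j + 1`.

After `ℓ - 1` rounds all polynomials are linear relative to that of `f_ℓ`, with slopes given by
`𝒜_{ℓ-1}`. Removing the other factors one at a time, now keeping both shifts `h, h'`, gives the box
norm (`IsRound.controls`).

All step counts depend on `ℓ` alone. Each step has an error of size `⌊δ'M⌋ / ⌊M⌋ ≤ 2δ'`; written
with a maximum (`Controls`), the errors do not accumulate, so `δ'` below a small multiple of a power
of `δ` suffices. -/

namespace PolyBox

open Finset

/-! ### Bounded functions supported on a translate, and normalised correlations -/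

/-- `f` is bounded by `1` and supported on a translate of `S`. -/
def TransBdd (S : Finset ℤ) (f : ℤ → ℂ) : Prop :=
  (∀ x, ‖f x‖ ≤ 1) ∧ ∃ c, ∀ x, x + c ∉ S → f x = 0

namespace TransBdd

variable {S : Finset ℤ} {f g : ℤ → ℂ}

theorem exists_finset (hf : TransBdd S f) :
    ∃ T : Finset ℤ, T.card = S.card ∧ ∀ x, x ∉ T → f x = 0 := by
  obtain ⟨-, c, hc⟩ := hf
  refine ⟨S.map (Equiv.subRight c).toEmbedding, by simp, fun x hx => hc x fun h => hx ?_⟩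
  simp only [mem_map_equiv]
  simpa using h

theorem summable (hf : TransBdd S f) : Summable f := by
  obtain ⟨T, -, hT⟩ := hf.exists_finset
  exact summable_of_ne_finset_zero hT

theorem norm_tsum_le (hf : TransBdd S f) : ‖∑' x, f x‖ ≤ S.card := by
  obtain ⟨T, hc, hT⟩ := hf.exists_finset
  rw [tsum_eq_sum hT, ← hc]
  simpa using norm_sum_le_of_le T (fun x _ => hf.1 x)

theorem shift (hf : TransBdd S f) (b : ℤ) : TransBdd S fun x => f (x + b) := by
  obtain ⟨h1, c, hc⟩ := hf
  refine ⟨fun x => h1 _, c + b, fun x hx => hc _ ?_⟩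
  rwa [add_assoc, add_comm b]

theorem conj (hf : TransBdd S f) : TransBdd S fun x => (starRingEnd ℂ) (f x) := by
  obtain ⟨h1, c, hc⟩ := hf
  exact ⟨fun x => by simpa using h1 x, c, fun x hx => by simp [hc x hx]⟩

theorem mul_of_norm_le (hf : TransBdd S f) (hg : ∀ x, ‖g x‖ ≤ 1) :
    TransBdd S fun x => f x * g x := by
  obtain ⟨h1, c, hc⟩ := hf
  refine ⟨fun x => ?_, c, fun x hx => by simp [hc x hx]⟩
  rw [norm_mul]
  exact mul_le_one₀ (h1 x) (norm_nonneg _) (hg x)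

theorem boxDiff (hf : TransBdd S f) (h : ℤ × ℤ) : TransBdd S (boxDiff h f) :=
  (hf.shift h.1).conj.mul_of_norm_le (hf.shift h.2).1

end TransBdd

/-- The normalised sum `(1 / (|S| m)) ∑_{y ∈ [m]} ∑_{x ∈ ℤ} F y x`. -/
noncomputable def corr (S : Finset ℤ) (m : ℕ) (F : ℤ → ℤ → ℂ) : ℂ :=
  (∑ y ∈ Icc (1 : ℤ) m, ∑' x, F y x) / ((S.card : ℂ) * m)

theorem corr_shift (S : Finset ℤ) (m : ℕ) (F : ℤ → ℤ → ℂ) (u : ℤ → ℤ) :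
    corr S m (fun y x => F y (x + u y)) = corr S m F := by
  unfold corr
  congr 1
  exact sum_congr rfl fun y _ => (Equiv.addRight (u y)).tsum_eq (F y)

theorem norm_corr_le_one {S : Finset ℤ} {m : ℕ} {F : ℤ → ℤ → ℂ}
    (hF : ∀ y, TransBdd S (F y)) : ‖corr S m F‖ ≤ 1 := by
  unfold corr
  rw [norm_div, norm_mul, Complex.norm_natCast, Complex.norm_natCast]
  refine div_le_one_of_le₀ ?_ (by positivity)
  refine (norm_sum_le_of_le _ fun y _ => (hF y).norm_tsum_le).trans ?_
  simp [mul_comm]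

/-- A unit shift of the window changes only the two end terms, which costs `2B`; iterate `h` times.
-/
theorem norm_sum_shift_sub_le {B : ℝ} {W : ℤ → ℂ} (hW : ∀ y, ‖W y‖ ≤ B) (m h : ℕ) :
    ‖∑ y ∈ Icc (1 : ℤ) m, W (y + h) - ∑ y ∈ Icc (1 : ℤ) m, W y‖ ≤ 2 * h * B := by
  induction h with
  | zero => simp
  | succ h ih =>
    have key : ∀ (n : ℕ) (W : ℤ → ℂ), ∑ y ∈ Icc (1 : ℤ) n, W (y + 1) - ∑ y ∈ Icc (1 : ℤ) n, W y
        = W (n + 1) - W 1 := by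
      intro n W
      induction n with
      | zero => simp
      | succ n ihn =>
        have : Icc (1 : ℤ) ((n + 1 : ℕ) : ℤ) = insert ((n : ℤ) + 1) (Icc (1 : ℤ) n) := by
          ext y; simp only [mem_Icc, mem_insert]; push_cast; omega
        rw [this, sum_insert (by simp), sum_insert (by simp)]
        push_cast
        linear_combination ihn
    have h1 := key m (fun y => W (y + h))
    have h2 : ∑ y ∈ Icc (1 : ℤ) m, W (y + (h + 1 : ℕ)) = ∑ y ∈ Icc (1 : ℤ) m, W (y + 1 + h) :=
      sum_congr rfl fun y _ => by congr 1; push_cast; ring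
    rw [h2]
    calc _ = ‖(W (m + 1 + h) - W (1 + h)) +
          (∑ y ∈ Icc (1 : ℤ) m, W (y + h) - ∑ y ∈ Icc (1 : ℤ) m, W y)‖ := by
          congr 1; linear_combination h1
      _ ≤ (B + B) + 2 * h * B :=
          (norm_add_le _ _).trans (add_le_add ((norm_sub_le _ _).trans
            (add_le_add (hW _) (hW _))) ih)
      _ = _ := by push_cast; ring

theorem sum_norm_sq_le_tsum {S : Finset ℤ} {G : ℤ → ℤ → ℂ} (I : Finset ℤ)
    (hG : ∀ h, TransBdd S (G h)) (T : Finset ℤ) :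
    ∑ x ∈ T, ‖∑ h ∈ I, G h x‖ ^ 2 ≤
      (∑ h ∈ I, ∑ h' ∈ I, ∑' x, (starRingEnd ℂ) (G h x) * G h' x).re := by
  have hs : ∀ h h', Summable fun x => (starRingEnd ℂ) (G h x) * G h' x := fun h h' =>
    ((hG h).conj.mul_of_norm_le (hG h').1).summable
  have e : ∀ x, ∑ h ∈ I, ∑ h' ∈ I, (starRingEnd ℂ) (G h x) * G h' x =
      ((‖∑ h ∈ I, G h x‖ ^ 2 : ℝ) : ℂ) := by
    intro x
    rw [← sum_mul_sum, ← map_sum, mul_comm, Complex.mul_conj, Complex.normSq_eq_norm_sq]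
  have hs2 : Summable fun x => ((‖∑ h ∈ I, G h x‖ ^ 2 : ℝ) : ℂ) := by
    simp_rw [← e]
    exact summable_sum fun h _ => summable_sum fun h' _ => hs h h'
  have : ∑ h ∈ I, ∑ h' ∈ I, ∑' x, (starRingEnd ℂ) (G h x) * G h' x =
      ((∑' x, ‖∑ h ∈ I, G h x‖ ^ 2 : ℝ) : ℂ) := by
    rw [Complex.ofReal_tsum]
    simp_rw [← e]
    rw [Summable.tsum_finsetSum fun h _ => summable_sum fun h' _ => hs h h']
    refine sum_congr rfl fun h _ => ?_
    rw [Summable.tsum_finsetSum fun h' _ => hs h h']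
  rw [this, Complex.ofReal_re]
  exact Summable.sum_le_tsum T (fun _ _ => by positivity) (Complex.summable_ofReal.mp hs2)

/-- Van der Corput's inequality: the sum over `y` is replaced by its average over shifts `y + h`,
Cauchy–Schwarz over the pairs `(x, y)` removes `g`, and the square over `h` is expanded. Both shifts
are kept; the box norm needs this form. -/
theorem norm_corr_mul_sq_le {S : Finset ℤ} (hS : S.Nonempty) {m H : ℕ} (hm : 1 ≤ m) (hH : 1 ≤ H)
    {g : ℤ → ℂ} (hg : TransBdd S g) {F : ℤ → ℤ → ℂ} (hF : ∀ y, TransBdd S (F y)) :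
    ‖corr S m (fun y x => g x * F y x)‖ ^ 2 ≤ 8 * ((H : ℝ) / m) ^ 2 +
      2 * (𝔼 h ∈ Icc (1 : ℤ) H, 𝔼 h' ∈ Icc (1 : ℤ) H,
        corr S m (fun y x => (starRingEnd ℂ) (F (y + h) x) * F (y + h') x)).re := by
  obtain ⟨T, hTc, hT⟩ := hg.exists_finset
  have hS' : (0 : ℝ) < S.card := by exact_mod_cast hS.card_pos
  have hm' : (0 : ℝ) < m := by exact_mod_cast hm
  have hH' : (0 : ℝ) < H := by exact_mod_cast hH
  set I := Icc (1 : ℤ) H with hI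
  set Y := Icc (1 : ℤ) m with hY
  have cI : (I.card : ℝ) = H := by simp [hI]
  have cY : (Y.card : ℝ) = m := by simp [hY]
  set X : ℂ := ∑ y ∈ Y, ∑' x, g x * F y x with hX
  set Z : ℝ := (∑ y ∈ Y, ∑ h ∈ I, ∑ h' ∈ I,
    ∑' x, (starRingEnd ℂ) (F (y + h) x) * F (y + h') x).re with hZ
  have e1 : X = ∑ x ∈ T, g x * ∑ y ∈ Y, F y x := by
    simp_rw [mul_sum]
    rw [sum_comm, hX]
    refine sum_congr rfl fun y _ => tsum_eq_sum fun x hx => by simp [hT x hx]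
  have e2 : ‖X‖ ≤ ∑ x ∈ T, ‖∑ y ∈ Y, F y x‖ := by
    rw [e1]
    refine norm_sum_le_of_le _ fun x _ => ?_
    rw [norm_mul]
    exact mul_le_of_le_one_left (norm_nonneg _) (hg.1 x)
  -- The boundary cost is at most `2H` for each of the `H` shifts, hence `2H²`.
  have e3 : ∀ x, (H : ℝ) * ‖∑ y ∈ Y, F y x‖ ≤ ∑ y ∈ Y, ‖∑ h ∈ I, F (y + h) x‖ + 2 * H ^ 2 := by
    intro x
    have a1 : ‖∑ h ∈ I, (∑ y ∈ Y, F (y + h) x - ∑ y ∈ Y, F y x)‖ ≤ ∑ h ∈ I, (2 * H * 1 : ℝ) := by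
      refine norm_sum_le_of_le _ fun h hh => ?_
      rw [hI, mem_Icc] at hh
      lift h to ℕ using by omega
      refine (norm_sum_shift_sub_le (W := fun y => F y x) (fun y => (hF y).1 x) m h).trans ?_
      have : (h : ℝ) ≤ H := by exact_mod_cast hh.2
      linarith
    rw [sum_sub_distrib, sum_const, sum_const, nsmul_eq_mul, nsmul_eq_mul, cI] at a1
    have a2 : (H : ℝ) * ‖∑ y ∈ Y, F y x‖ = ‖(I.card : ℂ) * ∑ y ∈ Y, F y x‖ := by
      rw [norm_mul, Complex.norm_natCast, cI]
    rw [a2]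
    have a3 := norm_sub_norm_le ((I.card : ℂ) * ∑ y ∈ Y, F y x) (∑ h ∈ I, ∑ y ∈ Y, F (y + h) x)
    rw [norm_sub_rev] at a3
    have a4 : ‖∑ h ∈ I, ∑ y ∈ Y, F (y + h) x‖ ≤ ∑ y ∈ Y, ‖∑ h ∈ I, F (y + h) x‖ := by
      rw [sum_comm]; exact norm_sum_le _ _
    nlinarith
  have e4 : (H : ℝ) * ‖X‖ ≤
      ∑ x ∈ T, ∑ y ∈ Y, ‖∑ h ∈ I, F (y + h) x‖ + 2 * H ^ 2 * S.card := by
    calc (H : ℝ) * ‖X‖ ≤ H * ∑ x ∈ T, ‖∑ y ∈ Y, F y x‖ := by gcongr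
      _ ≤ ∑ x ∈ T, (∑ y ∈ Y, ‖∑ h ∈ I, F (y + h) x‖ + 2 * H ^ 2) := by
          rw [mul_sum]; exact sum_le_sum fun x _ => e3 x
      _ = _ := by rw [sum_add_distrib, sum_const, hTc, nsmul_eq_mul]; ring
  have e5 : (∑ x ∈ T, ∑ y ∈ Y, ‖∑ h ∈ I, F (y + h) x‖) ^ 2 ≤ S.card * m * Z := by
    rw [← sum_product']
    refine (sq_sum_le_card_mul_sum_sq).trans ?_
    rw [card_product, Nat.cast_mul, hTc, cY, sum_product, sum_comm, hZ, Complex.re_sum]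
    gcongr with y _
    exact sum_norm_sq_le_tsum I (fun h => hF (y + h)) T
  have e6 : (𝔼 h ∈ I, 𝔼 h' ∈ I,
        corr S m (fun y x => (starRingEnd ℂ) (F (y + h) x) * F (y + h') x)).re
        = Z / (S.card * m * H ^ 2) := by
    have : 𝔼 h ∈ I, 𝔼 h' ∈ I,
        corr S m (fun y x => (starRingEnd ℂ) (F (y + h) x) * F (y + h') x) =
        (∑ y ∈ Y, ∑ h ∈ I, ∑ h' ∈ I,
          ∑' x, (starRingEnd ℂ) (F (y + h) x) * F (y + h') x) /
          ((S.card * m * H ^ 2 : ℝ) : ℂ) := by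
      simp only [corr, expect_eq_sum_div_card, ← sum_div, div_div]
      have c2 : (I.card : ℂ) = H := by exact_mod_cast cI
      rw [c2]
      congr 1
      · conv_rhs => rw [sum_comm]
        exact sum_congr rfl fun h _ => sum_comm
      · push_cast; ring
    rw [this, Complex.div_ofReal_re]
  rw [e6]
  unfold corr
  rw [norm_div, norm_mul, Complex.norm_natCast, Complex.norm_natCast, ← hY, ← hX]
  set A := ∑ x ∈ T, ∑ y ∈ Y, ‖∑ h ∈ I, F (y + h) x‖
  have e7 : ((H : ℝ) * ‖X‖) ^ 2 ≤ 2 * (S.card * m * Z) + 8 * (H ^ 2 * S.card) ^ 2 := by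
    calc ((H : ℝ) * ‖X‖) ^ 2 ≤ (A + 2 * H ^ 2 * S.card) ^ 2 := by gcongr
      _ ≤ 2 * A ^ 2 + 8 * (H ^ 2 * S.card) ^ 2 := by
        nlinarith [sq_nonneg (A - 2 * H ^ 2 * S.card)]
      _ ≤ _ := by gcongr
  have e8 : (‖X‖ / (S.card * m)) ^ 2 = ((H : ℝ) * ‖X‖) ^ 2 / (H * S.card * m) ^ 2 := by
    field_simp
  have e9 : 8 * ((H : ℝ) / m) ^ 2 + 2 * (Z / (S.card * m * H ^ 2)) =
      (2 * (S.card * m * Z) + 8 * (H ^ 2 * S.card) ^ 2) / (H * S.card * m) ^ 2 := by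
    field_simp
    ring
  rw [e8, e9]
  gcongr

/-! ### The van der Corput inequality with uniformly distributed shifts -/

theorem card_symmInterval_le {X : ℝ} (hX : 1 ≤ X) :
    ((symmInterval X).card : ℝ) ≤ 3 * ⌊X⌋₊ := by
  have h1 : (1 : ℤ) ≤ ⌊X⌋₊ := by exact_mod_cast (Nat.one_le_floor_iff X).mpr hX
  have hsub : symmInterval X ⊆ Icc (-(⌊X⌋₊ : ℤ)) ⌊X⌋₊ := by
    intro u hu
    rw [mem_symmInterval] at hu
    have h2 : X < (⌊X⌋₊ : ℝ) + 1 := Nat.lt_floor_add_one X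
    rw [mem_Icc]
    constructor
    · have : (-(⌊X⌋₊ : ℤ) - 1 : ℝ) < u := by push_cast; linarith
      have : -(⌊X⌋₊ : ℤ) - 1 < u := by exact_mod_cast this
      omega
    · have : (u : ℝ) < ((⌊X⌋₊ : ℤ) + 1 : ℝ) := by push_cast; linarith
      have : u < (⌊X⌋₊ : ℤ) + 1 := by exact_mod_cast this
      omega
  have h3 := card_le_card hsub
  rw [Int.card_Icc] at h3
  have h4 : (symmInterval X).card ≤ 3 * ⌊X⌋₊ := by omega
  exact_mod_cast h4

theorem symmInterval_nonempty {X : ℝ} (hX : 1 ≤ X) : (symmInterval X).Nonempty :=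
  ⟨0, by rw [mem_symmInterval]; constructor <;> push_cast <;> linarith⟩

/-- For fixed `h` the differences `h' - h` are distinct points of `(-X, X)`, so a value is taken by
at most `⌊X⌋` pairs; the factor `3` is the bound for the ratio of `|(-X, X) ∩ ℤ|` to `⌊X⌋`. -/
theorem expect_sub_le {X : ℝ} (hX : 1 ≤ X) {G : ℤ → ℝ} (hG : ∀ u, 0 ≤ G u) :
    𝔼 h ∈ Icc (1 : ℤ) ⌊X⌋₊, 𝔼 h' ∈ Icc (1 : ℤ) ⌊X⌋₊, G (h' - h) ≤
      3 * 𝔼 u ∈ symmInterval X, G u := by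
  set H := ⌊X⌋₊ with hHdef
  have h1 : 1 ≤ H := (Nat.one_le_floor_iff X).mpr hX
  have h1' : (0 : ℝ) < H := by exact_mod_cast h1
  have hHX : (H : ℝ) ≤ X := Nat.floor_le (by linarith)
  have hU : (0 : ℝ) < (symmInterval X).card := by
    exact_mod_cast (symmInterval_nonempty hX).card_pos
  have key : ∑ h ∈ Icc (1 : ℤ) H, ∑ h' ∈ Icc (1 : ℤ) H, G (h' - h) ≤
      H * ∑ u ∈ symmInterval X, G u := by
    have : ∀ h ∈ Icc (1 : ℤ) H, ∑ h' ∈ Icc (1 : ℤ) H, G (h' - h) ≤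
        ∑ u ∈ symmInterval X, G u := by
      intro h hh
      rw [mem_Icc] at hh
      rw [← sum_image (f := G) (g := fun h' => h' - h) (fun a _ b _ hab => by simpa using hab)]
      refine sum_le_sum_of_subset_of_nonneg ?_ fun u _ _ => hG u
      intro u hu
      obtain ⟨h', hh', rfl⟩ := mem_image.mp hu
      rw [mem_Icc] at hh'
      rw [mem_symmInterval]
      have a1 : (1 : ℝ) ≤ h := by exact_mod_cast hh.1
      have a2 : (h : ℝ) ≤ H := by exact_mod_cast hh.2
      have a3 : (1 : ℝ) ≤ h' := by exact_mod_cast hh'.1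
      have a4 : (h' : ℝ) ≤ H := by exact_mod_cast hh'.2
      push_cast
      constructor <;> linarith
    refine (sum_le_sum this).trans ?_
    simp
  simp only [expect_eq_sum_div_card, ← sum_div, div_div]
  have cI : ((Icc (1 : ℤ) H).card : ℝ) = H := by simp
  rw [cI]
  have hs : 0 ≤ ∑ u ∈ symmInterval X, G u := sum_nonneg fun u _ => hG u
  calc _ ≤ (H * ∑ u ∈ symmInterval X, G u) / (H * H) := by gcongr
    _ = (∑ u ∈ symmInterval X, G u) / H := by field_simp
    _ ≤ 3 * ((∑ u ∈ symmInterval X, G u) / (symmInterval X).card) := by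
      rw [div_le_iff₀ h1', mul_assoc, div_mul_eq_mul_div, mul_div_assoc', le_div_iff₀ hU]
      nlinarith [card_symmInterval_le hX]

theorem re_expect {ι : Type*} (s : Finset ι) (f : ι → ℂ) :
    (𝔼 i ∈ s, f i).re = 𝔼 i ∈ s, (f i).re := by
  rw [expect_eq_sum_div_card, expect_eq_sum_div_card, ← Complex.re_sum]
  exact_mod_cast Complex.div_natCast_re _ _

/-- The form with a single uniform shift: translating `y` by `h'` makes the correlation depend on `u
= h' - h` only, at a boundary cost of `2⌊X⌋ / m`. -/
theorem norm_corr_mul_sq_le_expect {S : Finset ℤ} (hS : S.Nonempty) {m : ℕ} {X : ℝ} (hX : 1 ≤ X)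
    (hm : ⌊X⌋₊ ≤ m) {g : ℤ → ℂ} (hg : TransBdd S g) {F : ℤ → ℤ → ℂ}
    (hF : ∀ y, TransBdd S (F y)) :
    ‖corr S m (fun y x => g x * F y x)‖ ^ 2 ≤ 12 * ((⌊X⌋₊ : ℝ) / m) +
      6 * 𝔼 u ∈ symmInterval X,
        ‖corr S m (fun y x => F y x * (starRingEnd ℂ) (F (y - u) x))‖ := by
  set H := ⌊X⌋₊ with hHdef
  have h1 : 1 ≤ H := (Nat.one_le_floor_iff X).mpr hX
  have hm1 : 1 ≤ m := h1.trans hm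
  have hm' : (0 : ℝ) < m := by exact_mod_cast hm1
  have hS' : (0 : ℝ) < S.card := by exact_mod_cast hS.card_pos
  have hη : (H : ℝ) / m ≤ 1 := div_le_one_of_le₀ (by exact_mod_cast hm) hm'.le
  have hη0 : 0 ≤ (H : ℝ) / m := by positivity
  have hne : (Icc (1 : ℤ) H).Nonempty := ⟨1, by simp; exact_mod_cast h1⟩
  set G : ℤ → ℝ := fun u => ‖corr S m (fun y x => F y x * (starRingEnd ℂ) (F (y - u) x))‖
  have hb : ∀ h ∈ Icc (1 : ℤ) H, ∀ h' ∈ Icc (1 : ℤ) H,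
      (corr S m (fun y x => (starRingEnd ℂ) (F (y + h) x) * F (y + h') x)).re ≤
        G (h' - h) + 2 * ((H : ℝ) / m) := by
    intro h _ h' hh'
    rw [mem_Icc] at hh'
    refine (Complex.re_le_norm _).trans ?_
    lift h' to ℕ using by omega
    set W : ℤ → ℂ := fun y => ∑' x, F y x * (starRingEnd ℂ) (F (y - (h' - h)) x)
    have hW : ∀ y, ‖W y‖ ≤ S.card := fun y =>
      ((hF y).mul_of_norm_le (hF _).conj.1).norm_tsum_le
    have hw := norm_sum_shift_sub_le hW m h'
    have e1 : corr S m (fun y x => (starRingEnd ℂ) (F (y + h) x) * F (y + h') x) =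
        (∑ y ∈ Icc (1 : ℤ) m, W (y + h')) / ((S.card : ℂ) * m) := by
      unfold corr
      congr 1
      refine sum_congr rfl fun y _ => tsum_congr fun x => ?_
      rw [mul_comm, show y + (h' : ℤ) - (h' - h) = y + h by ring]
    have e2 : ‖corr S m (fun y x => (starRingEnd ℂ) (F (y + h) x) * F (y + h') x) -
        corr S m (fun y x => F y x * (starRingEnd ℂ) (F (y - (h' - h)) x))‖ ≤
        2 * ((H : ℝ) / m) := by
      rw [e1]
      unfold corr
      rw [← sub_div, norm_div, norm_mul, Complex.norm_natCast, Complex.norm_natCast,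
        div_le_iff₀ (by positivity)]
      refine hw.trans ?_
      have : (h' : ℝ) ≤ H := by exact_mod_cast hh'.2
      calc 2 * (h' : ℝ) * S.card ≤ 2 * H * S.card := by gcongr
        _ = _ := by field_simp
    have e3 := norm_le_norm_sub_add (corr S m (fun y x => (starRingEnd ℂ) (F (y + h) x) * F (y + h') x))
      (corr S m (fun y x => F y x * (starRingEnd ℂ) (F (y - (h' - h)) x)))
    linarith
  have hc := norm_corr_mul_sq_le hS hm1 h1 hg hF
  rw [re_expect] at hc
  simp_rw [re_expect] at hc
  have hd : 𝔼 h ∈ Icc (1 : ℤ) H, 𝔼 h' ∈ Icc (1 : ℤ) H,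
      (corr S m (fun y x => (starRingEnd ℂ) (F (y + h) x) * F (y + h') x)).re ≤
      3 * (𝔼 u ∈ symmInterval X, G u) + 2 * ((H : ℝ) / m) := by
    calc _ ≤ 𝔼 h ∈ Icc (1 : ℤ) H, 𝔼 h' ∈ Icc (1 : ℤ) H, (G (h' - h) + 2 * ((H : ℝ) / m)) :=
          expect_le_expect fun h hh => expect_le_expect fun h' hh' => hb h hh h' hh'
      _ = (𝔼 h ∈ Icc (1 : ℤ) H, 𝔼 h' ∈ Icc (1 : ℤ) H, G (h' - h)) + 2 * ((H : ℝ) / m) := by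
          simp_rw [expect_add_distrib, expect_const hne]
      _ ≤ _ := by
          gcongr
          exact expect_sub_le hX fun u => norm_nonneg _
  -- With `η = H / m ≤ 1` the total is `8η² + 2(3𝔼G + 2η) ≤ 12η + 6𝔼G`.
  nlinarith

/-! ### Averages over boxes -/

theorem expect_sq_le {ι : Type*} (s : Finset ι) (f : ι → ℝ) :
    (𝔼 i ∈ s, f i) ^ 2 ≤ 𝔼 i ∈ s, f i ^ 2 := by
  rcases s.eq_empty_or_nonempty with rfl | hs
  · simp
  have hc : (0 : ℝ) < s.card := by exact_mod_cast hs.card_pos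
  rw [expect_eq_sum_div_card, expect_eq_sum_div_card, div_pow, div_le_div_iff₀ (by positivity) hc]
  nlinarith [sq_sum_le_card_mul_sum_sq (s := s) (f := f)]

theorem expect_pow_two_pow_le {ι : Type*} (s : Finset ι) (f : ι → ℝ) (hf : ∀ i, 0 ≤ f i) (n : ℕ) :
    (𝔼 i ∈ s, f i) ^ 2 ^ n ≤ 𝔼 i ∈ s, f i ^ 2 ^ n := by
  induction n with
  | zero => simp
  | succ n ih =>
    rw [pow_succ, pow_mul]
    calc _ ≤ (𝔼 i ∈ s, f i ^ 2 ^ n) ^ 2 := by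
          gcongr
          exact pow_nonneg (expect_nonneg fun i _ => hf i) _
      _ ≤ _ := by
          simp_rw [pow_mul]
          exact expect_sq_le _ _

/-- Exchanging the coordinate `a v` with `u` is an involution of the set of pairs `(a, u)`. This
lets the shift of a van der Corput step be absorbed into the average over the parameters. -/
theorem expect_update {V E : Type*} [Fintype V] [DecidableEq V] [AddCommGroup E] [Module ℚ≥0 E]
    {U : Finset ℤ} (hU : U.Nonempty) (v : V) (G : (V → ℤ) → E) :
    𝔼 a ∈ Fintype.piFinset (fun _ : V => U), 𝔼 u ∈ U, G (Function.update a v u) =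
      𝔼 a ∈ Fintype.piFinset (fun _ : V => U), G a := by
  set A := Fintype.piFinset (fun _ : V => U)
  have h1 : 𝔼 a ∈ A, 𝔼 u ∈ U, G (Function.update a v u) =
      𝔼 p ∈ A ×ˢ U, G (Function.update p.1 v p.2) := by rw [expect_product]
  have h2 : 𝔼 a ∈ A, G a = 𝔼 p ∈ A ×ˢ U, G p.1 := by
    rw [expect_product]
    simp_rw [expect_const hU]
  rw [h1, h2]
  refine expect_nbij' (fun p => (Function.update p.1 v p.2, p.1 v))
    (fun p => (Function.update p.1 v p.2, p.1 v)) ?_ ?_ ?_ ?_ ?_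
  · rintro ⟨a, u⟩ h
    simp only [mem_product, A, Fintype.mem_piFinset] at h ⊢
    refine ⟨fun w => ?_, h.1 v⟩
    rcases eq_or_ne w v with rfl | hw
    · simpa using h.2
    · simpa [hw] using h.1 w
  · rintro ⟨a, u⟩ h
    simp only [mem_product, A, Fintype.mem_piFinset] at h ⊢
    refine ⟨fun w => ?_, h.1 v⟩
    rcases eq_or_ne w v with rfl | hw
    · simpa using h.2
    · simpa [hw] using h.1 w
  · rintro ⟨a, u⟩ _; simp
  · rintro ⟨a, u⟩ _; simp
  · rintro ⟨a, u⟩ _; rfl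

section

/-! ### Parametrised systems of polynomials -/

/-- A function bounded by `1` and supported on `S`, attached to an integer polynomial that depends
on parameters `a : V → ℤ`. -/
structure Factor (S : Finset ℤ) (V : Type*) where
  fn : ℤ → ℂ
  poly : (V → ℤ) → Polynomial ℤ
  norm_le : ∀ x, ‖fn x‖ ≤ 1
  eq_zero : ∀ x, x ∉ S → fn x = 0

variable {S : Finset ℤ} {V : Type*}

namespace Factor

theorem transBdd (t : Factor S V) : TransBdd S t.fn :=
  ⟨t.norm_le, 0, fun x hx => t.eq_zero x (by simpa using hx)⟩

/-- The factor with the conjugate function. -/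
noncomputable def conj (t : Factor S V) : Factor S V where
  fn x := (starRingEnd ℂ) (t.fn x)
  poly := t.poly
  norm_le x := by simpa using t.norm_le x
  eq_zero x hx := by simp [t.eq_zero x hx]

/-- The factor with another polynomial. -/
noncomputable def withPoly (t : Factor S V) (Q : (V → ℤ) → Polynomial ℤ) : Factor S V :=
  { t with poly := Q }

end Factor

/-- A van der Corput step is given by the name of its shift parameter and by the polynomial that is
subtracted. -/
abbrev Move (V : Type*) := V × ((V → ℤ) → Polynomial ℤ)

/-- The two factors that a van der Corput step makes of one. -/
noncomputable def Factor.step (mv : Move V) (shifted : Bool) (t : Factor S V) : Factor S V :=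
  if shifted then
    t.conj.withPoly fun a => (t.poly a - mv.2 a).comp (Polynomial.X - Polynomial.C (a mv.1))
  else t.withPoly fun a => t.poly a - mv.2 a

/-- The effect of a van der Corput step on a list of factors. -/
noncomputable def applyMove (mv : Move V) (L : List (Factor S V)) : List (Factor S V) :=
  L.flatMap fun t => [t.step mv false, t.step mv true]

/-- The effect of a list of van der Corput steps on a list of factors. -/
noncomputable def run : List (Move V) → List (Factor S V) → List (Factor S V)
  | [], L => L
  | mv :: mvs, L => run mvs (applyMove mv L)

@[simp] theorem run_nil (L : List (Factor S V)) : run [] L = L := rfl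

theorem run_cons (mv : Move V) (mvs : List (Move V)) (L : List (Factor S V)) :
    run (mv :: mvs) L = run mvs (applyMove mv L) := rfl

theorem applyMove_append (mv : Move V) (L L' : List (Factor S V)) :
    applyMove mv (L ++ L') = applyMove mv L ++ applyMove mv L' := by
  simp [applyMove]

theorem mem_applyMove {mv : Move V} {L : List (Factor S V)} {t : Factor S V} :
    t ∈ applyMove mv L ↔ ∃ s ∈ L, ∃ ε, t = s.step mv ε := by
  simp [applyMove, or_comm]

theorem length_applyMove (mv : Move V) (L : List (Factor S V)) :
    (applyMove mv L).length = 2 * L.length := by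
  simp [applyMove, mul_comm]

theorem applyMove_mono {mv : Move V} {L L' : List (Factor S V)} (h : L ⊆ L') :
    applyMove mv L ⊆ applyMove mv L' := by
  intro t ht
  rw [mem_applyMove] at ht ⊢
  obtain ⟨s, hs, ε, rfl⟩ := ht
  exact ⟨s, h hs, ε, rfl⟩

theorem run_append (mvs : List (Move V)) (L L' : List (Factor S V)) :
    run mvs (L ++ L') = run mvs L ++ run mvs L' := by
  induction mvs generalizing L L' with
  | nil => rfl
  | cons mv mvs ih => rw [run_cons, applyMove_append, ih]; rfl

theorem run_append_moves (mvs mvs' : List (Move V)) (L : List (Factor S V)) :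
    run (mvs ++ mvs') L = run mvs' (run mvs L) := by
  induction mvs generalizing L with
  | nil => rfl
  | cons mv mvs ih => rw [List.cons_append, run_cons, ih]; rfl

theorem length_run (mvs : List (Move V)) (L : List (Factor S V)) :
    (run mvs L).length = L.length * 2 ^ mvs.length := by
  induction mvs generalizing L with
  | nil => simp
  | cons mv mvs ih => rw [run_cons, ih, length_applyMove, List.length_cons, pow_succ]; ring

theorem run_ne_nil {mvs : List (Move V)} {L : List (Factor S V)} (h : L ≠ []) :
    run mvs L ≠ [] := by
  rw [← List.length_pos_iff] at h ⊢
  rw [length_run]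
  positivity

theorem run_mono {mvs : List (Move V)} {L L' : List (Factor S V)} (h : L ⊆ L') :
    run mvs L ⊆ run mvs L' := by
  induction mvs generalizing L L' with
  | nil => exact h
  | cons mv mvs ih => exact ih (applyMove_mono h)

theorem run_flatten (mvs : List (Move V)) (Ls : List (List (Factor S V))) :
    run mvs Ls.flatten = (Ls.map (run mvs)).flatten := by
  induction Ls with
  | nil =>
    induction mvs with
    | nil => rfl
    | cons mv mvs ih => rw [run_cons]; exact ih
  | cons L Ls ih => simp [run_append, ih]

/-! ### Invariants of systems -/

/-- The polynomials of any two factors in `L` differ by a polynomial of degree less than `D`. -/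
def Near (D : ℕ) (L : List (Factor S V)) : Prop :=
  ∀ t ∈ L, ∀ s ∈ L, ∀ a, ∀ n, D ≤ n → (t.poly a - s.poly a).coeff n = 0

/-- The polynomial of `t` does not depend on the parameter `v`. -/
def Factor.IndepOf [DecidableEq V] (t : Factor S V) (v : V) : Prop :=
  ∀ a u, t.poly (Function.update a v u) = t.poly a

/-- Each step of `mvs` subtracts the polynomial of a factor that descends from `G`. -/
def Follows : List (Move V) → List (Factor S V) → Prop
  | [], _ => True
  | mv :: mvs, G => (∃ g ∈ G, g.poly = mv.2) ∧ Follows mvs (applyMove mv G)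

theorem Near.mono {D : ℕ} {L L' : List (Factor S V)} (h : Near D L) (hL : L' ⊆ L) : Near D L' :=
  fun t ht s hs => h t (hL ht) s (hL hs)

theorem Near.mono_degree {D D' : ℕ} {L : List (Factor S V)} (h : Near D L) (hD : D ≤ D') :
    Near D' L :=
  fun t ht s hs a n hn => h t ht s hs a n (hD.trans hn)

theorem near_singleton (D : ℕ) (t : Factor S V) : Near D [t] := by
  intro s hs s' hs' a n _
  rw [List.mem_singleton] at hs hs'
  simp [hs, hs']

theorem Follows.mono {mvs : List (Move V)} {G G' : List (Factor S V)} (h : Follows mvs G)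
    (hG : G ⊆ G') : Follows mvs G' := by
  induction mvs generalizing G G' with
  | nil => trivial
  | cons mv mvs ih =>
    obtain ⟨⟨g, hg, e⟩, h2⟩ := h
    exact ⟨⟨g, hG hg, e⟩, ih h2 (applyMove_mono hG)⟩

theorem Follows.append {mvs mvs' : List (Move V)} {G : List (Factor S V)} (h : Follows mvs G)
    (h' : Follows mvs' (run mvs G)) : Follows (mvs ++ mvs') G := by
  induction mvs generalizing G with
  | nil => exact h'
  | cons mv mvs ih => exact ⟨h.1, ih h.2 h'⟩

theorem comp_X_sub_C_coeff (p : Polynomial ℤ) (b : ℤ) (n : ℕ) :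
    (p.comp (Polynomial.X - Polynomial.C b)).coeff n = (Polynomial.hasseDeriv n p).eval (-b) := by
  rw [← Polynomial.taylor_coeff, Polynomial.taylor_apply, map_neg, sub_eq_add_neg]

theorem coeff_comp_X_sub_C_of_le {p : Polynomial ℤ} {D : ℕ} (hp : ∀ n, D < n → p.coeff n = 0)
    (b : ℤ) {n : ℕ} (hn : D ≤ n) :
    (p.comp (Polynomial.X - Polynomial.C b)).coeff n = p.coeff n := by
  have : Polynomial.hasseDeriv n p = Polynomial.C (p.coeff n) := by
    ext k
    rw [Polynomial.hasseDeriv_coeff, Polynomial.coeff_C]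
    split_ifs with hk
    · simp [hk]
    · rw [hp _ (by omega), mul_zero]
  rw [comp_X_sub_C_coeff, this, Polynomial.eval_C]

/-- This second coefficient produces the factors `ℓ - j` and the linear dependence on the new
variable in the recursion for the `p_ω`. -/
theorem coeff_comp_X_sub_C_pred {p : Polynomial ℤ} {D : ℕ}
    (hp : ∀ n, D + 1 < n → p.coeff n = 0) (b : ℤ) :
    (p.comp (Polynomial.X - Polynomial.C b)).coeff D =
      p.coeff D - (D + 1) * p.coeff (D + 1) * b := by
  have : Polynomial.hasseDeriv D p =
      Polynomial.C (p.coeff D) + Polynomial.C ((D + 1) * p.coeff (D + 1)) * Polynomial.X := by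
    ext k
    rw [Polynomial.hasseDeriv_coeff, Polynomial.coeff_add, Polynomial.coeff_C]
    rcases k with _ | _ | k
    · simp
    · simp [add_comm 1 D]
    · rw [hp _ (by omega), Polynomial.coeff_C_mul, Polynomial.coeff_X]
      simp
  rw [comp_X_sub_C_coeff, this]
  simp
  ring

theorem Factor.step_poly (mv : Move V) (ε : Bool) (t : Factor S V) (a : V → ℤ) :
    (t.step mv ε).poly a = (t.poly a - mv.2 a).comp
      (Polynomial.X - Polynomial.C (if ε then a mv.1 else 0)) := by
  cases ε <;> simp [Factor.step, Factor.withPoly]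

/-- The polynomials of the factors in `L` differ from `r` by polynomials of degree at most `D`. -/
def Close (D : ℕ) (r : (V → ℤ) → Polynomial ℤ) (L : List (Factor S V)) : Prop :=
  ∀ t ∈ L, ∀ a, ∀ n, D < n → (t.poly a - r a).coeff n = 0

theorem Near.close {D : ℕ} {L : List (Factor S V)} (h : Near (D + 1) L) {g : Factor S V}
    (hg : g ∈ L) : Close D g.poly L := fun t ht a n hn => h t ht g hg a n hn

/-- The subtracted polynomial cancels in the difference, and relative to it both factors have degree
at most `D`, so shifts only alter coefficients of degree below `D`. -/
theorem coeff_step_sub {D : ℕ} {mv : Move V} {L : List (Factor S V)} (hr : Close D mv.2 L)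
    {s t : Factor S V} (hs : s ∈ L) (ht : t ∈ L) (ε ε' : Bool) (a : V → ℤ) {n : ℕ} (hn : D ≤ n) :
    ((s.step mv ε).poly a - (t.step mv ε').poly a).coeff n = (s.poly a - t.poly a).coeff n := by
  rw [Polynomial.coeff_sub, Factor.step_poly, Factor.step_poly,
    coeff_comp_X_sub_C_of_le (hr s hs a) _ hn, coeff_comp_X_sub_C_of_le (hr t ht a) _ hn,
    ← Polynomial.coeff_sub]
  congr 1
  ring

theorem Near.applyMove {D : ℕ} {mv : Move V} {L : List (Factor S V)} (h : Near D L)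
    (hr : Close D mv.2 L) : Near D (applyMove mv L) := by
  intro t ht s hs a n hn
  obtain ⟨t₀, ht₀, ε, rfl⟩ := mem_applyMove.mp ht
  obtain ⟨s₀, hs₀, ε', rfl⟩ := mem_applyMove.mp hs
  rw [coeff_step_sub hr ht₀ hs₀ ε ε' a hn]
  exact h t₀ ht₀ s₀ hs₀ a n hn

theorem Follows.near_run {D : ℕ} {mvs : List (Move V)} {G L : List (Factor S V)}
    (hF : Follows mvs G) (hL : Near (D + 1) L) (hG : G ⊆ L) : Near (D + 1) (run mvs L) := by
  induction mvs generalizing G L with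
  | nil => exact hL
  | cons mv mvs ih =>
    obtain ⟨⟨g, hg, e⟩, hF⟩ := hF
    refine ih hF (hL.applyMove ?_) (applyMove_mono hG)
    exact e ▸ (hL.mono_degree (Nat.le_succ _)).close (hG hg)

/-- The ambient system `L` guarantees that every subtracted polynomial is within degree `D` of all
factors; hence the finer closeness inside a single class `R` survives the steps that eliminate
another class. -/
theorem Follows.near_run_subset {D : ℕ} {mvs : List (Move V)} {G L R : List (Factor S V)}
    (hF : Follows mvs G) (hL : Near (D + 1) L) (hG : G ⊆ L) (hR : Near D R) (hRL : R ⊆ L) :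
    Near D (run mvs R) := by
  induction mvs generalizing G L R with
  | nil => exact hR
  | cons mv mvs ih =>
    obtain ⟨⟨g, hg, e⟩, hF⟩ := hF
    have hc := hL.close (hG hg)
    rw [e] at hc
    exact ih hF (hL.applyMove (e ▸ (hL.mono_degree (Nat.le_succ _)).close (hG hg)))
      (applyMove_mono hG)
      (hR.applyMove fun t ht => hc t (hRL ht)) (applyMove_mono hRL)

/-- The coefficient of degree `D` of the difference of a factor of `W` and one of `G` is `e`. -/
def Gap (D : ℕ) (e : (V → ℤ) → ℤ) (W G : List (Factor S V)) : Prop :=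
  ∀ t ∈ W, ∀ g ∈ G, ∀ a, (t.poly a - g.poly a).coeff D = e a

theorem Gap.applyMove {D : ℕ} {e : (V → ℤ) → ℤ} {mv : Move V} {W G L : List (Factor S V)}
    (h : Gap D e W G) (hr : Close D mv.2 L) (hW : W ⊆ L) (hG : G ⊆ L) :
    Gap D e (applyMove mv W) (applyMove mv G) := by
  intro t ht g hg a
  obtain ⟨t₀, ht₀, ε, rfl⟩ := mem_applyMove.mp ht
  obtain ⟨g₀, hg₀, ε', rfl⟩ := mem_applyMove.mp hg
  rw [coeff_step_sub hr (hW ht₀) (hG hg₀) ε ε' a le_rfl]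
  exact h t₀ ht₀ g₀ hg₀ a

theorem Follows.gap_run {D : ℕ} {e : (V → ℤ) → ℤ} {mvs : List (Move V)}
    {G₀ W G L : List (Factor S V)} (hF : Follows mvs G₀) (hL : Near (D + 1) L) (hG₀ : G₀ ⊆ L)
    (h : Gap D e W G) (hW : W ⊆ L) (hG : G ⊆ L) : Gap D e (run mvs W) (run mvs G) := by
  induction mvs generalizing G₀ W G L with
  | nil => exact h
  | cons mv mvs ih =>
    obtain ⟨⟨g, hg, e'⟩, hF⟩ := hF
    have hc := hL.close (hG₀ hg)
    rw [e'] at hc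
    exact ih hF (hL.applyMove (e' ▸ (hL.mono_degree (Nat.le_succ _)).close (hG₀ hg)))
      (applyMove_mono hG₀) (h.applyMove hc hW hG) (applyMove_mono hW) (applyMove_mono hG)

/-- Before each step, the polynomials in `W` have degree at most `D` relative to the polynomial
that is subtracted, with coefficient `c v` of degree `D` if `v` is the name of the step. -/
def Tracks (D : ℕ) (c : V → (V → ℤ) → ℤ) : List (Move V) → List (Factor S V) → Prop
  | [], _ => True
  | mv :: mvs, W => (Close D mv.2 W ∧
      ∀ t ∈ W, ∀ a, (t.poly a - mv.2 a).coeff D = c mv.1 a) ∧ Tracks D c mvs (applyMove mv W)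

theorem Tracks.append {D : ℕ} {c : V → (V → ℤ) → ℤ} {mvs mvs' : List (Move V)}
    {W : List (Factor S V)} (h : Tracks D c mvs W) (h' : Tracks D c mvs' (run mvs W)) :
    Tracks D c (mvs ++ mvs') W := by
  induction mvs generalizing W with
  | nil => exact h'
  | cons mv mvs ih => exact ⟨h.1, ih h.2 h'⟩

theorem Follows.tracks {D : ℕ} {c : V → (V → ℤ) → ℤ} {e : (V → ℤ) → ℤ} {mvs : List (Move V)}
    {W G L : List (Factor S V)} (hF : Follows mvs G) (hL : Near (D + 1) L)
    (h : Gap D e W G) (hW : W ⊆ L) (hG : G ⊆ L) (hc : ∀ mv ∈ mvs, c mv.1 = e) :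
    Tracks D c mvs W := by
  induction mvs generalizing W G L with
  | nil => trivial
  | cons mv mvs ih =>
    obtain ⟨⟨g, hg, e'⟩, hF⟩ := hF
    have hcl := hL.close (hG hg)
    rw [e'] at hcl
    refine ⟨⟨fun t ht => hcl t (hW ht), fun t ht a => ?_⟩, ?_⟩
    · rw [hc mv (by simp), ← e']
      exact h t ht g hg a
    · exact ih hF (hL.applyMove (e' ▸ (hL.mono_degree (Nat.le_succ _)).close (hG hg)))
        (h.applyMove hcl hW hG) (applyMove_mono hW) (applyMove_mono hG)
        fun mv' hmv' => hc mv' (by simp [hmv'])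

section Indep

variable [DecidableEq V]

theorem Factor.IndepOf.step {t g : Factor S V} {w : V} (ht : t.IndepOf w) (hg : g.IndepOf w)
    {mv : Move V} (e : g.poly = mv.2) (hw : w ≠ mv.1) (ε : Bool) : (t.step mv ε).IndepOf w := by
  intro a u
  rw [Factor.step_poly, Factor.step_poly, ht, ← e, hg, Function.update_of_ne hw.symm]

/-- A parameter enters a polynomial only through the step that bears its name or through a
subtracted polynomial, and the latter all descend from `L`. So variables reserved for later steps
remain fresh. -/
theorem Follows.indepOf_run {mvs : List (Move V)} {G L : List (Factor S V)} {w : V}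
    (hF : Follows mvs G) (hG : G ⊆ L) (hw : w ∉ mvs.map Prod.fst) (h : ∀ t ∈ L, t.IndepOf w) :
    ∀ t ∈ run mvs L, t.IndepOf w := by
  induction mvs generalizing G L with
  | nil => exact h
  | cons mv mvs ih =>
    obtain ⟨⟨g, hg, e⟩, hF⟩ := hF
    rw [List.map_cons, List.mem_cons, not_or] at hw
    refine ih hF (applyMove_mono hG) hw.2 fun t ht => ?_
    obtain ⟨t₀, ht₀, ε, rfl⟩ := mem_applyMove.mp ht
    exact (h t₀ ht₀).step (h g (hG hg)) e hw.1 ε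

end Indep

end

section

/-! ### The van der Corput step for systems -/

section

variable {S : Finset ℤ} {V : Type*}

/-- The normalised correlation of the factors in `L` at the parameters `a`. -/
noncomputable def systemCorr (m : ℕ) (L : List (Factor S V)) (a : V → ℤ) : ℂ :=
  corr S m fun y x => (L.map fun t => t.fn (x + (t.poly a).eval y)).prod

theorem transBdd_prod {L : List (Factor S V)} (hL : L ≠ []) (b : Factor S V → ℤ) :
    TransBdd S fun x => (L.map fun t => t.fn (x + b t)).prod := by
  have h : ∀ (L : List (Factor S V)) x, ‖(L.map fun t => t.fn (x + b t)).prod‖ ≤ 1 := by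
    intro L x
    induction L with
    | nil => simp
    | cons t L ih =>
      rw [List.map_cons, List.prod_cons, norm_mul]
      exact mul_le_one₀ (t.norm_le _) (norm_nonneg _) ih
  obtain ⟨t, L, rfl⟩ := List.exists_cons_of_ne_nil hL
  simp only [List.map_cons, List.prod_cons]
  exact (t.transBdd.shift (b t)).mul_of_norm_le (h L)

theorem prod_applyMove (mv : Move V) (L : List (Factor S V)) (a : V → ℤ) (x y : ℤ) :
    ((applyMove mv L).map fun t => t.fn (x + (t.poly a).eval y)).prod =
      (L.map fun t => t.fn (x + (t.poly a - mv.2 a).eval y)).prod *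
      (starRingEnd ℂ) (L.map fun t => t.fn (x + (t.poly a - mv.2 a).eval (y - a mv.1))).prod := by
  induction L with
  | nil => simp [applyMove]
  | cons t L ih =>
    have e : applyMove mv (t :: L) = t.step mv false :: t.step mv true :: applyMove mv L := rfl
    rw [e]
    simp only [List.map_cons, List.prod_cons, ih, map_mul]
    have e0 : (t.step mv false).fn (x + ((t.step mv false).poly a).eval y) =
        t.fn (x + (t.poly a - mv.2 a).eval y) := rfl
    have e1 : (t.step mv true).fn (x + ((t.step mv true).poly a).eval y) =
        (starRingEnd ℂ) (t.fn (x + (t.poly a - mv.2 a).eval (y - a mv.1))) := by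
      simp [Factor.step, Factor.withPoly, Factor.conj, Polynomial.eval_comp]
    rw [e0, e1]
    ring

/-- The parameters of the van der Corput process: a nonempty set `S` that supports the functions,
the length `m` of the summation over `y`, and a bound `X` for the shifts. -/
structure Admissible (S : Finset ℤ) (m : ℕ) (X : ℝ) : Prop where
  nonempty : S.Nonempty
  one_le : 1 ≤ X
  floor_le : ⌊X⌋₊ ≤ m

namespace Admissible

variable {m : ℕ} {X : ℝ}

theorem one_le_floor (h : Admissible S m X) : 1 ≤ ⌊X⌋₊ := (Nat.one_le_floor_iff X).mpr h.one_le

theorem one_le_nat (h : Admissible S m X) : 1 ≤ m := h.one_le_floor.trans h.floor_le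

theorem ratio_nonneg (_ : Admissible S m X) : 0 ≤ (⌊X⌋₊ : ℝ) / m := by positivity

theorem ratio_le_one (h : Admissible S m X) : (⌊X⌋₊ : ℝ) / m ≤ 1 :=
  div_le_one_of_le₀ (by exact_mod_cast h.floor_le) (Nat.cast_nonneg _)

end Admissible

variable [DecidableEq V]

theorem norm_systemCorr_sq_le {m : ℕ} {X : ℝ} (h : Admissible S m X) {G R : List (Factor S V)}
    {mv : Move V} (hG : ∀ g ∈ G, g.poly = mv.2) (hG0 : G ≠ []) (hR : R ≠ [])
    (hGi : ∀ g ∈ G, g.IndepOf mv.1) (hRi : ∀ t ∈ R, t.IndepOf mv.1) (a : V → ℤ) :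
    ‖systemCorr m (G ++ R) a‖ ^ 2 ≤ 12 * ((⌊X⌋₊ : ℝ) / m) +
      6 * 𝔼 u ∈ symmInterval X,
        ‖systemCorr m (applyMove mv R) (Function.update a mv.1 u)‖ := by
  set F : ℤ → ℤ → ℂ := fun y x => (R.map fun t => t.fn (x + (t.poly a - mv.2 a).eval y)).prod
  have hF : ∀ y, TransBdd S (F y) := fun y =>
    transBdd_prod hR fun t => (t.poly a - mv.2 a).eval y
  have hg : TransBdd S fun x => (G.map fun t => t.fn x).prod := by
    simpa using transBdd_prod hG0 fun _ => 0
  -- Translating `x` by the common polynomial of `G` makes that product independent of `y`.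
  have e1 : systemCorr m (G ++ R) a =
      corr S m (fun y x => (G.map fun t => t.fn x).prod * F y x) := by
    rw [← corr_shift S m _ fun y => (mv.2 a).eval y]
    unfold systemCorr
    congr 1
    funext y x
    rw [List.map_append, List.prod_append]
    congr 2
    · refine List.map_congr_left fun g hg => ?_
      rw [hG g hg]
    · refine List.map_congr_left fun t _ => ?_
      congr 1
      rw [Polynomial.eval_sub]
      ring
  have hr : ∀ u, mv.2 (Function.update a mv.1 u) = mv.2 a := by
    obtain ⟨g, G, rfl⟩ := List.exists_cons_of_ne_nil hG0
    rw [← hG g (by simp)]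
    exact fun u => hGi g (by simp) a u
  have e2 : ∀ u, systemCorr m (applyMove mv R) (Function.update a mv.1 u) =
      corr S m (fun y x => F y x * (starRingEnd ℂ) (F (y - u) x)) := by
    intro u
    unfold systemCorr
    congr 1
    funext y x
    rw [prod_applyMove, hr, Function.update_self]
    congr 2
    · refine List.map_congr_left fun t ht => ?_
      rw [hRi t ht]
    · congr 1
      refine List.map_congr_left fun t ht => ?_
      rw [hRi t ht]
  rw [e1]
  simp_rw [e2]
  exact norm_corr_mul_sq_le_expect h.nonempty h.one_le h.floor_le hg hF

/-- The average of the modulus of the correlation of `L` over the parameters. -/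
noncomputable def avgCorr [Fintype V] (m : ℕ) (X : ℝ) (L : List (Factor S V)) : ℝ :=
  𝔼 a ∈ Fintype.piFinset (fun _ : V => symmInterval X), ‖systemCorr m L a‖

theorem avgCorr_nonneg [Fintype V] (m : ℕ) (X : ℝ) (L : List (Factor S V)) : 0 ≤ avgCorr m X L :=
  expect_nonneg fun _ _ => norm_nonneg _

/-- Since no factor depends on the variable `mv.1`, it is free to serve as the new shift, and
averaging over that shift is again averaging over all parameters. -/
theorem avgCorr_sq_le [Fintype V] {m : ℕ} {X : ℝ} (h : Admissible S m X)
    {G R : List (Factor S V)}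
    {mv : Move V} (hG : ∀ g ∈ G, g.poly = mv.2) (hG0 : G ≠ []) (hR : R ≠ [])
    (hGi : ∀ g ∈ G, g.IndepOf mv.1) (hRi : ∀ t ∈ R, t.IndepOf mv.1) :
    avgCorr m X (G ++ R) ^ 2 ≤ 12 * ((⌊X⌋₊ : ℝ) / m) + 6 * avgCorr m X (applyMove mv R) := by
  have hne : (Fintype.piFinset (fun _ : V => symmInterval X)).Nonempty :=
    Fintype.piFinset_nonempty.mpr fun _ => symmInterval_nonempty h.one_le
  unfold avgCorr
  rw [← expect_update (symmInterval_nonempty h.one_le) mv.1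
    fun a => ‖systemCorr m (applyMove mv R) a‖]
  refine (expect_sq_le _ _).trans ((expect_le_expect fun a _ =>
    norm_systemCorr_sq_le h hG hG0 hR hGi hRi a).trans_eq ?_)
  rw [expect_add_distrib, expect_const hne, mul_expect]

end

/-! ### Chains of inequalities of Cauchy-Schwarz type -/

/-- The inequality that results from `k` applications of the Cauchy-Schwarz inequality with an
error of size `η` each. -/
def Controls (η : ℝ) (k : ℕ) (x z : ℝ) : Prop := (x / 18) ^ 2 ^ k ≤ max (z / 18) (η / 18)

namespace Controls

variable {η x y z : ℝ} {k l : ℕ}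

theorem refl (η x : ℝ) : Controls η 0 x x := by simp [Controls]

theorem of_sq_le (hz : x ^ 2 ≤ 12 * η + 6 * z) : Controls η 1 x z := by
  unfold Controls
  have h1 := le_max_left (z / 18) (η / 18)
  have h2 := le_max_right (z / 18) (η / 18)
  rw [pow_one, div_pow]
  -- `x² ≤ 12η + 6z ≤ 18 max(z, η)`; dividing by `18²` explains the normalisation by `18`.
  linarith

/-- If the error term dominates at the intermediate stage, its powers remain at most `η / 18`
because `η ≤ 1`; therefore the error does not grow along the chain. -/
theorem trans (h : Controls η k x y) (h' : Controls η l y z) (hx : 0 ≤ x)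
    (hη : 0 ≤ η) (hη1 : η ≤ 1) : Controls η (k + l) x z := by
  unfold Controls at *
  rw [pow_add, pow_mul]
  refine (pow_le_pow_left₀ (by positivity) h _).trans ?_
  rcases le_total (y / 18) (η / 18) with hc | hc
  · rw [max_eq_right hc]
    refine (pow_le_of_le_one (by positivity) (by linarith) (by positivity)).trans (le_max_right _ _)
  · rw [max_eq_left hc]
    exact h'

end Controls

/-! ### Elimination of a class of polynomials -/

/-- The numbers of steps in the elimination of `n` classes one after the other, when it takes
`κ m` steps to eliminate a class of `m` factors. Initially each class has `m` factors; each step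
doubles the sizes of the classes that remain. -/
def stepCounts (κ : ℕ → ℕ) : ℕ → ℕ → List ℕ
  | 0, _ => []
  | n + 1, m => κ m :: stepCounts κ n (m * 2 ^ κ m)

/-- The number of steps that eliminate a class of `m` factors whose polynomials differ by
polynomials of degree less than `d`. -/
def elimSteps : ℕ → ℕ → ℕ
  | 0, _ => 1
  | d + 1, m => (stepCounts (elimSteps d) m 1).sum

theorem length_stepCounts (κ : ℕ → ℕ) (n m : ℕ) : (stepCounts κ n m).length = n := by
  induction n generalizing m with
  | zero => rfl
  | succ n ih => simp [stepCounts, ih]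

theorem elimSteps_pos (d : ℕ) {m : ℕ} (hm : 1 ≤ m) : 1 ≤ elimSteps d m := by
  induction d generalizing m with
  | zero => exact le_rfl
  | succ d ih =>
    obtain ⟨n, rfl⟩ : ∃ n, m = n + 1 := ⟨m - 1, by omega⟩
    simp only [elimSteps, stepCounts, List.sum_cons]
    exact (ih le_rfl).trans (Nat.le_add_right _ _)

theorem stepCounts_pos (d : ℕ) {n m : ℕ} (hm : 1 ≤ m) :
    ∀ k ∈ stepCounts (elimSteps d) n m, 1 ≤ k := by
  induction n generalizing m with
  | zero => simp [stepCounts]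
  | succ n ih =>
    intro k hk
    rw [stepCounts, List.mem_cons] at hk
    rcases hk with rfl | hk
    · exact elimSteps_pos d hm
    · exact ih (Nat.one_le_iff_ne_zero.mpr (by positivity)) k hk

theorem exists_pieces {α : Type*} (ks : List ℕ) (l : List α) (h : l.length = ks.sum) :
    ∃ pieces : List (List α), pieces.flatten = l ∧ pieces.map List.length = ks := by
  induction ks generalizing l with
  | nil => exact ⟨[], (List.length_eq_zero_iff.mp h).symm, rfl⟩
  | cons k ks ih =>
    rw [List.sum_cons] at h
    obtain ⟨p, h1, h2⟩ := ih (l.drop k) (by simp; omega)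
    exact ⟨l.take k :: p, by simp [h1], by simp [h2]; omega⟩

variable {S : Finset ℤ} {V : Type*} [DecidableEq V] [Fintype V]

variable (S V) in
/-- Classes of factors whose polynomials differ by polynomials of degree less than `d` can be
eliminated. -/
def Eliminable (m : ℕ) (X : ℝ) (d : ℕ) : Prop :=
  ∀ (k : ℕ) (vs : List V) (G : List (Factor S V)), 1 ≤ k → G.length = k →
    vs.length = elimSteps d k → vs.Nodup → Near d G → (∀ t ∈ G, ∀ v ∈ vs, t.IndepOf v) →
    ∃ mvs : List (Move V), mvs.map Prod.fst = vs ∧ Follows mvs G ∧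
      ∀ R : List (Factor S V), R ≠ [] → (∀ t ∈ R, ∀ v ∈ vs, t.IndepOf v) →
        Controls (⌊X⌋₊ / m) vs.length (avgCorr m X (G ++ R)) (avgCorr m X (run mvs R))

/-- The classes are removed one after the other. The steps are determined by the classes alone, so
one list of steps serves every rest `R` and every bystander list `W`. The last conclusion records
the top coefficients of `W` relative to the subtracted polynomials: these are the initial gaps
between `W` and the respective classes, which earlier steps leave unchanged. -/
theorem exists_moves_of_eliminable {m : ℕ} {X : ℝ} (h : Admissible S m X) {d : ℕ}
    (hd : Eliminable S V m X d) (Cs : List (List V × List (Factor S V))) (k : ℕ) (hk : 1 ≤ k)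
    (hlen : ∀ p ∈ Cs, p.2.length = k)
    (hvs : Cs.map (fun p => p.1.length) = stepCounts (elimSteps d) Cs.length k)
    (hnd : (Cs.map Prod.fst).flatten.Nodup) (hnear : ∀ p ∈ Cs, Near d p.2)
    (hnear' : Near (d + 1) (Cs.map Prod.snd).flatten)
    (hind : ∀ t ∈ (Cs.map Prod.snd).flatten, ∀ v ∈ (Cs.map Prod.fst).flatten, t.IndepOf v) :
    ∃ mvs : List (Move V), mvs.map Prod.fst = (Cs.map Prod.fst).flatten ∧
      Follows mvs (Cs.map Prod.snd).flatten ∧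
      (∀ R : List (Factor S V), R ≠ [] →
        (∀ t ∈ R, ∀ v ∈ (Cs.map Prod.fst).flatten, t.IndepOf v) →
        Controls (⌊X⌋₊ / m) (Cs.map Prod.fst).flatten.length
          (avgCorr m X ((Cs.map Prod.snd).flatten ++ R)) (avgCorr m X (run mvs R))) ∧
      ∀ (c : V → (V → ℤ) → ℤ) (W : List (Factor S V)),
        Near (d + 1) ((Cs.map Prod.snd).flatten ++ W) →
        (∀ p ∈ Cs, ∃ e, Gap d e W p.2 ∧ ∀ v ∈ p.1, c v = e) → Tracks d c mvs W := by
  generalize hn : Cs.length = n at hvs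
  induction n generalizing Cs k with
  | zero =>
    obtain rfl := List.length_eq_zero_iff.mp hn
    refine ⟨[], rfl, trivial, fun R _ _ => ?_, fun _ _ _ _ => trivial⟩
    simpa using Controls.refl _ _
  | succ n ih =>
    obtain ⟨⟨vs, C⟩, Cs, rfl⟩ := List.exists_cons_of_length_eq_add_one hn
    rw [List.length_cons, Nat.add_right_cancel_iff] at hn
    simp only [List.map_cons, List.flatten_cons, stepCounts,
      List.cons.injEq, List.mem_cons, forall_eq_or_imp] at *
    obtain ⟨hlC, hlen⟩ := hlen
    obtain ⟨hvs, hvs'⟩ := hvs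
    obtain ⟨hnC, hnear⟩ := hnear
    rw [List.nodup_append'] at hnd
    obtain ⟨hnd1, hnd2, hdisj⟩ := hnd
    set vs' := (Cs.map Prod.fst).flatten with hvs'def
    set L := (Cs.map Prod.snd).flatten with hL
    obtain ⟨mvs, hm1, hF, hctrl⟩ := hd k vs C hk hlC hvs hnd1 hnC
      fun t ht v hv => hind t (by simp [ht]) v (by simp [hv])
    -- Eliminating the first class multiplies the sizes of the others by `2 ^ elimSteps d k`,
    -- exactly as in the recursion for `stepCounts`.
    set Cs' := Cs.map fun p => (p.1, run mvs p.2) with hCs'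
    have e1 : Cs'.map Prod.fst = Cs.map Prod.fst := by simp [hCs', Function.comp_def]
    have e2 : (Cs'.map Prod.snd).flatten = run mvs L := by
      rw [hL, run_flatten]; simp [hCs', Function.comp_def]
    have hlm : mvs.length = vs.length := by rw [← hm1, List.length_map]
    have hsub : ∀ p ∈ Cs, p.2 ⊆ L := fun p hp t ht =>
      List.mem_flatten.mpr ⟨p.2, List.mem_map_of_mem hp, ht⟩
    have hnot : ∀ v ∈ vs', v ∉ mvs.map Prod.fst := by
      rw [hm1]; exact fun v hv hv' => hdisj hv' hv
    have hCL : C ⊆ C ++ L := List.subset_append_left _ _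
    have hLL : L ⊆ C ++ L := List.subset_append_right _ _
    obtain ⟨mvs', hm1', hF', hctrl', htr'⟩ := ih Cs' (k * 2 ^ elimSteps d k)
      (Nat.one_le_iff_ne_zero.mpr (by positivity)) (by
        intro p' hp'
        obtain ⟨p, hp, rfl⟩ := List.mem_map.mp hp'
        rw [length_run, hlm, hvs, hlen p hp])
        (by rw [e1]; exact hnd2) (by
        intro p' hp'
        obtain ⟨p, hp, rfl⟩ := List.mem_map.mp hp'
        exact hF.near_run_subset hnear' hCL (hnear p hp)
          fun t ht => hLL (hsub p hp ht)) (by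
        rw [e2]
        exact (hF.near_run hnear' hCL).mono (run_mono hLL)) (by
        rw [e1, e2]
        intro t ht v hv
        refine hF.indepOf_run hCL (hnot v hv) (fun t ht => hind t ht v (List.mem_append_right _ hv)) t
          (run_mono hLL ht)) (by simpa [hCs'] using hn) (by
        simpa [hCs', Function.comp_def] using hvs')
    rw [e1] at hm1' hctrl'
    rw [e2] at hF' hctrl' htr'
    refine ⟨mvs ++ mvs', by simp [hm1, hm1', hvs'def], ?_, ?_, ?_⟩
    · exact (hF.mono hCL).append (hF'.mono (run_mono hLL))
    · intro R hR hRi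
      have hLR : L ++ R ≠ [] := by simp [hR]
      have c1 := hctrl (L ++ R) hLR (by
        intro t ht v hv
        rcases List.mem_append.mp ht with ht | ht
        · exact hind t (by simp [ht]) v (by simp [hv])
        · exact hRi t ht v (by simp [hv]))
      have c2 := hctrl' (run mvs R) (run_ne_nil hR) (by
        intro t ht v hv
        refine hF.indepOf_run (L := C ++ R) (List.subset_append_left _ _) (hnot v hv)
          (fun t ht => ?_) t (run_mono (List.subset_append_right _ _) ht)
        rcases List.mem_append.mp ht with ht | ht
        · exact hind t (by simp [ht]) v (List.mem_append_right _ hv)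
        · exact hRi t ht v (List.mem_append_right _ hv))
      rw [run_append] at c1
      rw [List.append_assoc, List.length_append, run_append_moves]
      exact c1.trans c2 (avgCorr_nonneg _ _ _) h.ratio_nonneg
        h.ratio_le_one
    · intro c W hW hgap
      obtain ⟨⟨e, he, hce⟩, hgap⟩ := hgap
      have hCW : C ⊆ C ++ L ++ W := fun t ht => by simp [ht]
      have hWW : W ⊆ C ++ L ++ W := fun t ht => by simp [ht]
      have hLW : L ⊆ C ++ L ++ W := fun t ht => by simp [ht]
      refine (hF.tracks hW he hWW hCW fun mv hmv => hce _ ?_).append (htr' c (run mvs W) ?_ ?_)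
      · rw [← hm1]; exact List.mem_map_of_mem hmv
      · rw [← run_append]
        exact (hF.near_run hW hCW).mono (run_mono fun t ht => by
          rcases List.mem_append.mp ht with ht | ht
          · exact hLW ht
          · exact hWW ht)
      · intro p' hp'
        obtain ⟨p, hp, rfl⟩ := List.mem_map.mp hp'
        obtain ⟨e, he, hce⟩ := hgap p hp
        exact ⟨e, hF.gap_run hW hCW he hWW (fun t ht => hLW (hsub p hp ht)), hce⟩

/-- Induction on `d`. If `d = 0`, all polynomials of the class coincide and one step removes it. For
`d + 1` the class is split into singletons, trivially `Near d`, to which the induction hypothesis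
applies successively. -/
theorem eliminable {m : ℕ} {X : ℝ} (h : Admissible S m X) (d : ℕ) : Eliminable S V m X d := by
  induction d with
  | zero =>
    intro k vs G hk hG hvs _ hnear hind
    obtain ⟨v, rfl⟩ := List.length_eq_one_iff.mp hvs
    have hG0 : G ≠ [] := by rw [← List.length_pos_iff]; omega
    obtain ⟨g, hg⟩ := List.exists_mem_of_ne_nil G hG0
    have hp : ∀ t ∈ G, t.poly = g.poly := by
      intro t ht
      funext a
      rw [← sub_eq_zero]
      ext n
      simpa using hnear t ht g hg a n (Nat.zero_le n)
    refine ⟨[(v, g.poly)], rfl, ⟨⟨g, hg, rfl⟩, trivial⟩, fun R hR hRi => ?_⟩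
    refine Controls.of_sq_le ?_
    exact avgCorr_sq_le (mv := (v, g.poly)) h hp hG0 hR
      (fun t ht => hind t ht v (by simp)) (fun t ht => hRi t ht v (by simp))
  | succ d ih =>
    intro k vs G hk hG hvs hnd hnear hind
    obtain ⟨pieces, rfl, hpl⟩ := exists_pieces _ _ hvs
    have hpc : pieces.length = G.length := by
      rw [← List.length_map (f := List.length), hpl, length_stepCounts, hG]
    set Cs := pieces.zip (G.map fun g => [g]) with hCs
    have e1 : Cs.map Prod.fst = pieces := List.map_fst_zip (by simp [hpc])
    have e2 : Cs.map Prod.snd = G.map fun g => [g] := List.map_snd_zip (by simp [hpc])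
    have e3 : (G.map fun g => [g]).flatten = G := by
      clear * -; induction G <;> simp_all
    have hs : ∀ p ∈ Cs, ∃ g, p.2 = [g] := by
      intro p hp
      have : p.2 ∈ Cs.map Prod.snd := List.mem_map_of_mem hp
      rw [e2] at this
      obtain ⟨g, -, hg⟩ := List.mem_map.mp this
      exact ⟨g, hg.symm⟩
    obtain ⟨mvs, h1, h2, h3, -⟩ := exists_moves_of_eliminable h ih Cs 1 le_rfl (by
      intro p hp
      obtain ⟨g, hg⟩ := hs p hp
      simp [hg]) (by
      have : Cs.map (fun p => p.1.length) = (Cs.map Prod.fst).map List.length := by simp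
      rw [this, e1, hpl]
      congr 1
      simp [hCs, hpc, hG]) (by rwa [e1]) (by
      intro p hp
      obtain ⟨g, hg⟩ := hs p hp
      rw [hg]
      exact near_singleton d g) (by rwa [e2, e3]) (by rwa [e1, e2, e3])
    rw [e1] at h1 h3
    rw [e2, e3] at h2 h3
    exact ⟨mvs, h1, h2, h3⟩

end

/-! ### The descendants of one factor -/

section

variable {S : Finset ℤ} {V : Type*} [DecidableEq V]

/-- The descendant of `t` under the steps `mvs` that is shifted at the steps with name in `ω`. -/
noncomputable def Factor.descend (ω : Finset V) : List (Move V) → Factor S V → Factor S V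
  | [], t => t
  | mv :: mvs, t => Factor.descend ω mvs (t.step mv (decide (mv.1 ∈ ω)))

theorem Factor.descend_mem_run (ω : Finset V) (mvs : List (Move V)) {t : Factor S V}
    {L : List (Factor S V)} (ht : t ∈ L) : t.descend ω mvs ∈ run mvs L := by
  induction mvs generalizing t L with
  | nil => exact ht
  | cons mv mvs ih => exact ih (mem_applyMove.mpr ⟨t, ht, _, rfl⟩)

theorem Factor.descend_congr {ω ω' : Finset V} (mvs : List (Move V)) (t : Factor S V)
    (h : ∀ mv ∈ mvs, mv.1 ∈ ω ↔ mv.1 ∈ ω') : t.descend ω mvs = t.descend ω' mvs := by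
  induction mvs generalizing t with
  | nil => rfl
  | cons mv mvs ih =>
    simp only [Factor.descend, h mv (by simp)]
    exact ih _ fun mv' h' => h mv' (by simp [h'])

theorem Factor.descend_empty_fn (mvs : List (Move V)) (t : Factor S V) :
    (t.descend ∅ mvs).fn = t.fn := by
  induction mvs generalizing t with
  | nil => rfl
  | cons mv mvs ih => exact (ih _).trans (by simp [Factor.step, Factor.withPoly])

/-- The descendants of `t` are the leaves of a binary tree; as the names are distinct, a leaf is
determined by the set of names at which the shifted branch was taken. -/
theorem prod_run_singleton {M : Type*} [CommMonoid M] (F : Factor S V → M) {mvs : List (Move V)}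
    (hnd : (mvs.map Prod.fst).Nodup) (t : Factor S V) :
    ((run mvs [t]).map F).prod =
      ∏ ω ∈ (mvs.map Prod.fst).toFinset.powerset, F (t.descend ω mvs) := by
  induction mvs generalizing t with
  | nil => simp [Factor.descend]
  | cons mv mvs ih =>
    rw [List.map_cons, List.nodup_cons] at hnd
    have e : run (mv :: mvs) [t] = run mvs [t.step mv false] ++ run mvs [t.step mv true] := by
      rw [run_cons, ← run_append]; rfl
    have hv : mv.1 ∉ (mvs.map Prod.fst).toFinset := by simpa using hnd.1
    rw [e, List.map_append, List.prod_append, ih hnd.2, ih hnd.2, List.map_cons,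
      List.toFinset_cons, prod_powerset_insert hv]
    congr 1
    · refine prod_congr rfl fun ω hω => ?_
      have : mv.1 ∉ ω := fun h => hv (mem_powerset.mp hω h)
      simp [Factor.descend, this]
    · refine prod_congr rfl fun ω hω => ?_
      simp only [Factor.descend, mem_insert_self, decide_true]
      refine congrArg F (Factor.descend_congr mvs _ fun mv' h' => ?_)
      have : mv'.1 ≠ mv.1 := fun h => hnd.1 (h ▸ List.mem_map_of_mem h')
      simp [this]

/-- A shift by `a v` of a polynomial with coefficient `c v a` of degree `D + 1` lowers its
coefficient of degree `D` by `(D + 1) * c v a * a v`. The first descendant is never shifted, so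
these amounts add up with a positive sign. -/
theorem Tracks.coeff_descend_sub {D : ℕ} {c : V → (V → ℤ) → ℤ} {mvs : List (Move V)}
    {W : List (Factor S V)} (h : Tracks (D + 1) c mvs W) {s t : Factor S V} (hs : s ∈ W)
    (ht : t ∈ W) (ω : Finset V) (a : V → ℤ) :
    ((s.descend ∅ mvs).poly a - (t.descend ω mvs).poly a).coeff D =
      (s.poly a - t.poly a).coeff D +
        (mvs.map fun mv => if mv.1 ∈ ω then (D + 1) * c mv.1 a * a mv.1 else 0).sum := by
  induction mvs generalizing W s t with
  | nil => simp [Factor.descend]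
  | cons mv mvs ih =>
    obtain ⟨⟨h1, h2⟩, h3⟩ := h
    simp only [Factor.descend, notMem_empty, decide_false]
    rw [ih h3 (mem_applyMove.mpr ⟨s, hs, _, rfl⟩) (mem_applyMove.mpr ⟨t, ht, _, rfl⟩),
      List.map_cons, List.sum_cons, ← add_assoc]
    congr 1
    rw [Polynomial.coeff_sub, Factor.step_poly, Factor.step_poly,
      coeff_comp_X_sub_C_pred (h1 s hs a), coeff_comp_X_sub_C_pred (h1 t ht a), h2 s hs, h2 t ht]
    simp only [Polynomial.coeff_sub, Bool.false_eq_true, if_false, decide_eq_true_eq]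
    split_ifs <;> ring

theorem Tracks.coeff_descend_self_sub {D : ℕ} {c : V → (V → ℤ) → ℤ} {mvs : List (Move V)}
    {s : Factor S V} (h : Tracks (D + 1) c mvs [s]) (hnd : (mvs.map Prod.fst).Nodup)
    {ω : Finset V} (hω : ω ⊆ (mvs.map Prod.fst).toFinset) (a : V → ℤ) :
    ((s.descend ∅ mvs).poly a - (s.descend ω mvs).poly a).coeff D =
      ∑ v ∈ ω, (D + 1) * c v a * a v := by
  rw [h.coeff_descend_sub (by simp) (by simp) ω a, sub_self, Polynomial.coeff_zero, zero_add]
  have := List.sum_toFinset (fun v => if v ∈ ω then ((D : ℤ) + 1) * c v a * a v else 0) hnd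
  rw [List.map_map] at this
  rw [Function.comp_def] at this
  rw [← this, sum_ite_mem, inter_eq_right.mpr hω]

end

/-! ### The numbers of steps -/

/-- The number of factors that belong to one index at the beginning of round `j`. -/
def initialSize (ℓ j : ℕ) : ℕ := if j = 0 then ℓ else 1

/-- The numbers of steps for the elimination of the classes with index in `I` in round `j`. -/
noncomputable def levelCount (ℓ j : ℕ) (I : Finset (Idx j)) (i : Idx j) : ℕ :=
  (stepCounts (elimSteps (ℓ - j)) I.card (initialSize ℓ j)).getD (I.toList.idxOf i) 1

/-- The index sets that result from the numbers `levelCount`. -/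
noncomputable def levelSet (ℓ : ℕ) : (j : ℕ) → Finset (Idx j)
  | 0 => {()}
  | j + 1 => (((levelSet ℓ j).sigma fun i =>
      Icc 1 (levelCount ℓ j (levelSet ℓ j) i)).powerset).erase ∅

/-- The number `k_i` of steps that eliminate the class with index `i ∈ I_j`. -/
noncomputable def levelSteps (ℓ j : ℕ) (i : Idx j) : ℕ := levelCount ℓ j (levelSet ℓ j) i

theorem indexSet_levelSteps (ℓ j : ℕ) : indexSet (levelSteps ℓ) j = levelSet ℓ j := by
  induction j with
  | zero => rfl
  | succ j ih =>
    simp only [indexSet, levelSet, ih, levelSteps]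
    rfl

theorem one_le_initialSize {ℓ : ℕ} (hℓ : 1 ≤ ℓ) (j : ℕ) : 1 ≤ initialSize ℓ j := by
  unfold initialSize
  split_ifs <;> omega

theorem one_le_levelSteps {ℓ : ℕ} (hℓ : 1 ≤ ℓ) (j : ℕ) (i : Idx j) : 1 ≤ levelSteps ℓ j i := by
  unfold levelSteps levelCount
  rw [List.getD_eq_getElem?_getD]
  cases h : (stepCounts (elimSteps (ℓ - j)) (levelSet ℓ j).card (initialSize ℓ j))[
      (levelSet ℓ j).toList.idxOf i]? with
  | none => simp
  -- Outside the list the default value is `1`, so positivity holds for every index.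
  | some k => exact stepCounts_pos _ (one_le_initialSize hℓ j) k (List.mem_of_getElem? h)

theorem map_levelSteps (ℓ j : ℕ) :
    (indexSet (levelSteps ℓ) j).toList.map (levelSteps ℓ j) =
      stepCounts (elimSteps (ℓ - j)) (indexSet (levelSteps ℓ) j).card (initialSize ℓ j) := by
  rw [indexSet_levelSteps]
  refine List.ext_getElem (by simp [length_stepCounts]) fun n h1 h2 => ?_
  rw [List.getElem_map, levelSteps, levelCount, List.Nodup.idxOf_getElem (nodup_toList _),
    List.getD_eq_getElem _ _ h2]

/-! ### The rounds of the elimination -/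

section

variable {k : (j : ℕ) → Idx j → ℕ} {ℓ : ℕ}

theorem mem_varSet {j : ℕ} {w : (_ : Idx j) × ℕ} :
    (⟨j, w⟩ : Var) ∈ varSet k ℓ ↔
      j < ℓ - 1 ∧ w ∈ (indexSet k j).sigma fun i => Icc 1 (k j i) := by
  simp [varSet]

theorem mem_indexSet_succ {j : ℕ} {ω : Idx (j + 1)} :
    ω ∈ indexSet k (j + 1) ↔
      ω.ones ≠ ∅ ∧ ω.ones ⊆ (indexSet k j).sigma fun i => Icc 1 (k j i) := by
  rw [indexSet]
  exact mem_erase.trans (and_congr_right fun _ => mem_powerset)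

open scoped Classical in
/-- The variables of level `j` that belong to the index `i`. -/
noncomputable def classVars (k : (j : ℕ) → Idx j → ℕ) (ℓ j : ℕ) (i : Idx j) :
    Finset (varSet k ℓ) :=
  univ.filter fun v => ∃ r, v.1 = ⟨j, i, r⟩

open scoped Classical in
/-- The set of variables at which `ω` equals `1`. -/
noncomputable def Idx.vars (k : (j : ℕ) → Idx j → ℕ) (ℓ : ℕ) {j : ℕ} (ω : Idx (j + 1)) :
    Finset (varSet k ℓ) :=
  univ.filter fun v => ∃ w ∈ ω.ones, v.1 = ⟨j, w⟩

theorem mem_classVars {j : ℕ} {i : Idx j} {v : varSet k ℓ} :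
    v ∈ classVars k ℓ j i ↔ ∃ r, v.1 = ⟨j, i, r⟩ := by simp [classVars]

theorem Idx.mem_vars {j : ℕ} {ω : Idx (j + 1)} {v : varSet k ℓ} :
    v ∈ ω.vars k ℓ ↔ ∃ w ∈ ω.ones, v.1 = ⟨j, w⟩ := by simp [Idx.vars]

theorem var_mk_inj {j : ℕ} {w w' : (_ : Idx j) × ℕ} :
    (⟨j, w⟩ : Var) = ⟨j, w'⟩ ↔ w = w' :=
  ⟨fun h => eq_of_heq (Sigma.mk.inj h).2, fun h => h ▸ rfl⟩

theorem card_classVars {j : ℕ} (hj : j < ℓ - 1) {i : Idx j} (hi : i ∈ indexSet k j) :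
    (classVars k ℓ j i).card = k j i := by
  have hm : ∀ r ∈ Icc 1 (k j i), (⟨j, i, r⟩ : Var) ∈ varSet k ℓ := fun r hr =>
    mem_varSet.mpr ⟨hj, mem_sigma.mpr ⟨hi, hr⟩⟩
  have : (Icc 1 (k j i)).card = (classVars k ℓ j i).card := by
    refine card_bij (fun r hr => ⟨⟨j, i, r⟩, hm r hr⟩) (fun r hr => mem_classVars.mpr ⟨r, rfl⟩)
      (fun r hr r' hr' h => ?_) fun v hv => ?_
    · have h1 := var_mk_inj.mp (Subtype.mk.inj h)
      exact eq_of_heq (Sigma.mk.inj h1).2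
    · obtain ⟨r, hr⟩ := mem_classVars.mp hv
      have h2 := v.2
      rw [hr, mem_varSet, mem_sigma] at h2
      exact ⟨r, h2.2.2, Subtype.ext hr.symm⟩
  rw [← this, Nat.card_Icc, Nat.add_sub_cancel]

theorem sum_vars {M : Type*} [AddCommMonoid M] {j : ℕ} (hj : j < ℓ - 1) {ω : Idx (j + 1)}
    (hω : ω ∈ indexSet k (j + 1)) (F : Var → M) :
    ∑ v ∈ ω.vars k ℓ, F v = ∑ w ∈ ω.ones, F ⟨j, w⟩ := by
  have hm : ∀ w ∈ ω.ones, (⟨j, w⟩ : Var) ∈ varSet k ℓ := fun w hw =>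
    mem_varSet.mpr ⟨hj, (mem_indexSet_succ.mp hω).2 hw⟩
  refine (sum_bij (fun w hw => ⟨⟨j, w⟩, hm w hw⟩) (fun w hw => Idx.mem_vars.mpr ⟨w, hw, rfl⟩)
      (fun w hw w' hw' h => var_mk_inj.mp (Subtype.mk.inj h)) (fun v hv => ?_)
      fun w hw => rfl).symm
  obtain ⟨w, hw, h⟩ := Idx.mem_vars.mp hv
  exact ⟨w, hw, Subtype.ext h.symm⟩

theorem evalAt_dirPoly_succ {c : ℤ} {j : ℕ} (hj : j < ℓ - 1) {ω : Idx (j + 1)}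
    (hω : ω ∈ indexSet k (j + 1)) (a : varSet k ℓ → ℤ) :
    evalAt (varSet k ℓ) a (dirPoly ℓ c (j + 1) ω) =
      ∑ v ∈ ω.vars k ℓ, ((ℓ : ℤ) - j) * evalAt (varSet k ℓ) a (dirPoly ℓ c v.1.1 v.1.2.1) * a v := by
  have e : ∀ v : varSet k ℓ, ((ℓ : ℤ) - j) *
      evalAt (varSet k ℓ) a (dirPoly ℓ c v.1.1 v.1.2.1) * a v = ((ℓ : ℤ) - j) *
      evalAt (varSet k ℓ) a (dirPoly ℓ c v.1.1 v.1.2.1) *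
      (fun v : Var => if hv : v ∈ varSet k ℓ then a ⟨v, hv⟩ else 0) v := by
    intro v; simp
  simp_rw [e]
  rw [sum_vars hj hω (fun v => ((ℓ : ℤ) - j) * evalAt (varSet k ℓ) a (dirPoly ℓ c v.1 v.2.1) *
    (fun v : Var => if hv : v ∈ varSet k ℓ then a ⟨v, hv⟩ else 0) v)]
  simp only [dirPoly, evalAt, map_sum, map_mul, MvPolynomial.eval_C, MvPolynomial.eval_X]

/-- The variables of level `j`, as a list that is ordered by the indices to which they belong. -/
noncomputable def levelVars (k : (j : ℕ) → Idx j → ℕ) (ℓ j : ℕ) : List (varSet k ℓ) :=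
  ((indexSet k j).toList.map fun i => (classVars k ℓ j i).toList).flatten

theorem mem_levelVars {j : ℕ} {v : varSet k ℓ} : v ∈ levelVars k ℓ j ↔ v.1.1 = j := by
  simp only [levelVars, List.mem_flatten, List.mem_map, mem_toList, exists_exists_and_eq_and,
    mem_classVars]
  constructor
  · rintro ⟨i, -, r, h⟩
    rw [h]
  · obtain ⟨⟨j', i, r⟩, hv⟩ := v
    rintro rfl
    exact ⟨i, (mem_sigma.mp (mem_varSet.mp hv).2).1, r, rfl⟩

theorem nodup_levelVars (j : ℕ) : (levelVars k ℓ j).Nodup := by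
  rw [levelVars, List.nodup_flatten]
  constructor
  · intro l hl
    obtain ⟨i, -, rfl⟩ := List.mem_map.mp hl
    exact nodup_toList _
  · rw [List.pairwise_map]
    refine (nodup_toList _).imp fun {i i'} hne v hv hv' => hne ?_
    rw [mem_toList, mem_classVars] at hv hv'
    obtain ⟨r, h⟩ := hv
    obtain ⟨r', h'⟩ := hv'
    rw [h] at h'
    exact (Sigma.mk.inj (var_mk_inj.mp h')).1

/-- Nonempty sets of level-`j` variables are the same as elements of `I_{j+1}`, via `Idx.vars`. This
matches the descendants of the distinguished factor with the index set of the next round. -/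
theorem prod_indexSet_succ {M : Type*} [CommMonoid M] {j : ℕ} (hj : j < ℓ - 1)
    (F : Finset (varSet k ℓ) → M) :
    ∏ ω ∈ (levelVars k ℓ j).toFinset.powerset.erase ∅, F ω =
      ∏ ω ∈ indexSet k (j + 1), F (ω.vars k ℓ) := by
  classical
  symm
  have hm : ∀ ω ∈ indexSet k (j + 1), ∀ w ∈ ω.ones, (⟨j, w⟩ : Var) ∈ varSet k ℓ :=
    fun ω hω w hw => mem_varSet.mpr ⟨hj, (mem_indexSet_succ.mp hω).2 hw⟩
  refine prod_bij (fun ω _ => ω.vars k ℓ) (fun ω hω => ?_) (fun ω hω ω' hω' h => ?_)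
    (fun τ hτ => ?_) fun _ _ => rfl
  · rw [mem_erase, mem_powerset]
    constructor
    · obtain ⟨w, hw⟩ := nonempty_iff_ne_empty.mpr (mem_indexSet_succ.mp hω).1
      exact ne_empty_of_mem (Idx.mem_vars.mpr ⟨w, hw, rfl⟩ : (⟨_, hm ω hω w hw⟩ : varSet k ℓ) ∈ _)
    · intro v hv
      obtain ⟨w, hw, h⟩ := Idx.mem_vars.mp hv
      rw [List.mem_toFinset, mem_levelVars, h]
  · have key : ∀ ω ω' : Idx (j + 1), ω ∈ indexSet k (j + 1) →
        ω.vars k ℓ ⊆ ω'.vars k ℓ → ω.ones ⊆ ω'.ones := by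
      intro ω ω' hω h w hw
      have h1 := h (Idx.mem_vars.mpr ⟨w, hw, rfl⟩ : (⟨_, hm ω hω w hw⟩ : varSet k ℓ) ∈ _)
      obtain ⟨w', hw', e⟩ := Idx.mem_vars.mp h1
      exact (var_mk_inj.mp e) ▸ hw'
    exact Subset.antisymm (key ω ω' hω h.subset) (key ω' ω hω' h.symm.subset)
  · rw [mem_erase, mem_powerset] at hτ
    set s := (indexSet k j).sigma fun i => Icc 1 (k j i) with hs
    set ω : Idx (j + 1) := s.filter fun w => ∃ v ∈ τ, v.1 = ⟨j, w⟩ with hω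
    have hmem : ∀ w, w ∈ ω.ones ↔ ∃ v ∈ τ, v.1 = ⟨j, w⟩ := by
      intro w
      refine mem_filter.trans (and_iff_right_of_imp ?_)
      rintro ⟨v, -, hv⟩
      have := v.2
      rw [hv, mem_varSet] at this
      exact this.2
    have hvars : ω.vars k ℓ = τ := by
      ext v
      rw [Idx.mem_vars]
      constructor
      · rintro ⟨w, hw, h⟩
        obtain ⟨v', hv', h'⟩ := (hmem w).mp hw
        rwa [Subtype.ext (h.trans h'.symm)]
      · intro hv
        have h1 := mem_levelVars.mp (List.mem_toFinset.mp (hτ.2 hv))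
        obtain ⟨⟨j', w⟩, hv'⟩ := v
        obtain rfl : j' = j := h1
        exact ⟨w, (hmem w).mpr ⟨_, hv, rfl⟩, rfl⟩
    refine ⟨ω, mem_indexSet_succ.mpr ⟨fun h => hτ.1 ?_, filter_subset _ _⟩, hvars⟩
    rw [← hvars]
    refine eq_empty_of_forall_notMem fun v hv => ?_
    obtain ⟨w, hw, -⟩ := Idx.mem_vars.mp hv
    rw [h] at hw
    exact notMem_empty _ hw

end

/-! ### Passage from one round to the next -/

section

variable {S : Finset ℤ}

/-- The system in which the factor `s` is distinguished and the other factors form the classes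
`C i`, `i ∈ I_j`. -/
noncomputable def roundSystem {ℓ j : ℕ} (s : Factor S (varSet (levelSteps ℓ) ℓ))
    (C : Idx j → List (Factor S (varSet (levelSteps ℓ) ℓ))) :
    List (Factor S (varSet (levelSteps ℓ) ℓ)) :=
  ((indexSet (levelSteps ℓ) j).toList.map C).flatten ++ [s]

/-- The properties of the system at the beginning of round `j`: relative to the polynomial of `s`,
those in the class of `i` have degree at most `ℓ - j` with coefficient `-p_i(a)`. -/
structure IsRound (ℓ j : ℕ) (c : ℤ) (s : Factor S (varSet (levelSteps ℓ) ℓ))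
    (C : Idx j → List (Factor S (varSet (levelSteps ℓ) ℓ))) : Prop where
  length : ∀ i ∈ indexSet (levelSteps ℓ) j, (C i).length = initialSize ℓ j
  near : ∀ i ∈ indexSet (levelSteps ℓ) j, Near (ℓ - j) (C i)
  near_all : Near (ℓ - j + 1) (roundSystem s C)
  gap : ∀ i ∈ indexSet (levelSteps ℓ) j, Gap (ℓ - j)
    (fun a => evalAt (varSet (levelSteps ℓ) ℓ) a (dirPoly ℓ c j i)) [s] (C i)
  indep : ∀ t ∈ roundSystem s C, ∀ v : varSet (levelSteps ℓ) ℓ, j ≤ v.1.1 → t.IndepOf v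

theorem systemCorr_congr {V : Type*} (m : ℕ) {L L' : List (Factor S V)}
    (h : ∀ F : Factor S V → ℂ, (L.map F).prod = (L'.map F).prod) :
    systemCorr m L = systemCorr m L' := by
  funext a
  unfold systemCorr
  simp_rw [h]

/-- All classes are eliminated with `R = [s]`, so that only descendants of `s` survive. The
unshifted one is the new distinguished factor, and each other one forms a class of size one. -/
theorem IsRound.next {m : ℕ} {X : ℝ} (h : Admissible S m X) {ℓ j : ℕ} {c : ℤ} (hj : j < ℓ - 1)
    {s : Factor S (varSet (levelSteps ℓ) ℓ)}
    {C : Idx j → List (Factor S (varSet (levelSteps ℓ) ℓ))} (hR : IsRound ℓ j c s C) :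
    ∃ (s' : Factor S (varSet (levelSteps ℓ) ℓ))
      (C' : Idx (j + 1) → List (Factor S (varSet (levelSteps ℓ) ℓ))),
      s'.fn = s.fn ∧ IsRound ℓ (j + 1) c s' C' ∧
      Controls (⌊X⌋₊ / m) (levelVars (levelSteps ℓ) ℓ j).length
        (avgCorr m X (roundSystem s C)) (avgCorr m X (roundSystem s' C')) := by
  set I := indexSet (levelSteps ℓ) j with hI
  set Cs := I.toList.map fun i => ((classVars (levelSteps ℓ) ℓ j i).toList, C i) with hCs
  set L := (I.toList.map C).flatten with hL
  have e1 : (Cs.map Prod.fst).flatten = levelVars (levelSteps ℓ) ℓ j := by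
    simp [hCs, levelVars, Function.comp_def, hI]
  have e2 : (Cs.map Prod.snd).flatten = L := by
    simp [hCs, hL, Function.comp_def]
  have hcs : ∀ p ∈ Cs, ∃ i ∈ I, p = ((classVars (levelSteps ℓ) ℓ j i).toList, C i) := by
    intro p hp
    obtain ⟨i, hi, rfl⟩ := List.mem_map.mp hp
    exact ⟨i, mem_toList.mp hi, rfl⟩
  have hD : ℓ - j = ℓ - (j + 1) + 1 := by omega
  have hsL : L ⊆ L ++ [s] := List.subset_append_left _ _
  have hss : [s] ⊆ L ++ [s] := List.subset_append_right _ _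
  obtain ⟨mvs, h1, hF, h3, h4⟩ := exists_moves_of_eliminable h (eliminable h (ℓ - j)) Cs
    (initialSize ℓ j) (one_le_initialSize (by omega) j) (by
      intro p hp
      obtain ⟨i, hi, rfl⟩ := hcs p hp
      exact hR.length i hi) (by
      rw [hCs, List.length_map, length_toList, ← map_levelSteps, List.map_map]
      refine List.map_congr_left fun i hi => ?_
      simp only [Function.comp_apply, length_toList]
      exact card_classVars hj (mem_toList.mp hi)) (by rw [e1]; exact nodup_levelVars j) (by
      intro p hp
      obtain ⟨i, hi, rfl⟩ := hcs p hp
      exact hR.near i hi) (by rw [e2]; exact hR.near_all.mono hsL) (by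
      rw [e1, e2]
      exact fun t ht v hv => hR.indep t (hsL ht) v (mem_levelVars.mp hv).ge)
  rw [e1] at h1 h3
  rw [e2] at hF h3 h4
  have hnd : (mvs.map Prod.fst).Nodup := h1 ▸ nodup_levelVars j
  -- A step named `a_{i,r}` subtracts a descendant of the class of `i`, relative to which the
  -- descendants of `s` have top coefficient `p_i(a)`.
  have htr : Tracks (ℓ - j) (fun v a => evalAt (varSet (levelSteps ℓ) ℓ) a (dirPoly ℓ c v.1.1 v.1.2.1))
      mvs [s] := by
    refine h4 _ _ hR.near_all fun p hp => ?_
    obtain ⟨i, hi, rfl⟩ := hcs p hp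
    refine ⟨_, hR.gap i hi, fun v hv => ?_⟩
    obtain ⟨r, hr⟩ := mem_classVars.mp (mem_toList.mp hv)
    funext a
    rw [hr]
  rw [hD] at htr
  have hsub : ∀ ω : Idx (j + 1), ω.vars (levelSteps ℓ) ℓ ⊆ (mvs.map Prod.fst).toFinset := by
    intro ω v hv
    obtain ⟨w, -, hw⟩ := Idx.mem_vars.mp hv
    rw [h1, List.mem_toFinset, mem_levelVars, hw]
  set s' := s.descend ∅ mvs with hs'
  set C' : Idx (j + 1) → List (Factor S (varSet (levelSteps ℓ) ℓ)) :=
    fun ω => [s.descend (ω.vars (levelSteps ℓ) ℓ) mvs] with hC'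
  have hsys : roundSystem s' C' =
      (indexSet (levelSteps ℓ) (j + 1)).toList.map (fun ω => s.descend (ω.vars (levelSteps ℓ) ℓ) mvs) ++ [s'] := by
    unfold roundSystem
    rw [hC', ← List.flatMap_def, ← List.map_eq_flatMap]
  have hrun : ∀ t ∈ roundSystem s' C', t ∈ run mvs [s] := by
    intro t ht
    rw [hsys, List.mem_append, List.mem_map, List.mem_singleton] at ht
    rcases ht with ⟨ω, -, rfl⟩ | rfl
    · exact Factor.descend_mem_run _ _ (by simp)
    · exact Factor.descend_mem_run _ _ (by simp)
  refine ⟨s', C', Factor.descend_empty_fn _ _, ⟨fun ω _ => ?_, fun ω _ => near_singleton _ _,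
    ?_, fun ω hω => ?_, fun t ht v hv => ?_⟩, ?_⟩
  · simp [hC', initialSize]
  · rw [← hD]
    exact (hF.near_run_subset hR.near_all hsL (near_singleton _ s) hss).mono hrun
  · intro t ht g hg a
    rw [List.mem_singleton] at ht hg
    rw [ht, hg, htr.coeff_descend_self_sub hnd (hsub ω)]
    refine Eq.trans ?_ (evalAt_dirPoly_succ hj hω a).symm
    refine sum_congr rfl fun v _ => ?_
    congr 2
    rw [Nat.cast_sub (by omega)]
    push_cast
    ring
  · refine hF.indepOf_run hsL ?_ (fun t ht => hR.indep t ht v (by omega)) t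
      (run_mono hss (hrun t ht))
    rw [h1, mem_levelVars]
    omega
  · have h5 := h3 [s] (by simp) fun t ht v hv =>
      hR.indep t (hss ht) v (mem_levelVars.mp hv).ge
    -- The two systems list the same factors in different orders; the empty set of names accounts
    -- for `s'`.
    have h6 : avgCorr m X (run mvs [s]) = avgCorr m X (roundSystem s' C') := by
      unfold avgCorr
      rw [systemCorr_congr m fun F => ?_]
      rw [prod_run_singleton F hnd, h1, hsys, List.map_append, List.prod_append, List.map_map,
        prod_map_toList, ← mul_prod_erase _ _ (empty_mem_powerset _),
        prod_indexSet_succ hj fun ω => F (s.descend ω mvs), mul_comm]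
      simp [hs']
    rw [← h6]
    exact h5

/-- The number of steps in the rounds before round `j`. -/
noncomputable def totalSteps (ℓ j : ℕ) : ℕ :=
  ∑ i ∈ range j, (levelVars (levelSteps ℓ) ℓ i).length

theorem IsRound.iterate {m : ℕ} {X : ℝ} (h : Admissible S m X) {ℓ : ℕ} {c : ℤ}
    {s : Factor S (varSet (levelSteps ℓ) ℓ)}
    {C : Idx 0 → List (Factor S (varSet (levelSteps ℓ) ℓ))} (hR : IsRound ℓ 0 c s C)
    {j : ℕ} (hj : j ≤ ℓ - 1) :
    ∃ (s' : Factor S (varSet (levelSteps ℓ) ℓ))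
      (C' : Idx j → List (Factor S (varSet (levelSteps ℓ) ℓ))),
      s'.fn = s.fn ∧ IsRound ℓ j c s' C' ∧
      Controls (⌊X⌋₊ / m) (totalSteps ℓ j)
        (avgCorr m X (roundSystem s C)) (avgCorr m X (roundSystem s' C')) := by
  induction j with
  | zero => exact ⟨s, C, rfl, hR, by simpa [totalSteps] using Controls.refl _ _⟩
  | succ j ih =>
    obtain ⟨s₁, C₁, e₁, hR₁, hc₁⟩ := ih (by omega)
    obtain ⟨s₂, C₂, e₂, hR₂, hc₂⟩ := hR₁.next h (by omega)
    refine ⟨s₂, C₂, e₂.trans e₁, hR₂, ?_⟩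
    rw [totalSteps, sum_range_succ]
    exact hc₁.trans hc₂ (avgCorr_nonneg _ _ _) h.ratio_nonneg h.ratio_le_one

end

/-! ### Linear systems and box norms -/

section

variable {ι : Type*}

/-- `Δ'` with differences `(q_i h_i, q_i h'_i)` for `i ∈ s`. -/
noncomputable def partialDiffs (s : Finset ι) (q h h' : ι → ℤ) (f : ℤ → ℂ) : ℤ → ℂ :=
  (s.val.map fun i => (q i * h i, q i * h' i)).foldr boxDiff f

theorem partialDiffs_empty (q h h' : ι → ℤ) (f : ℤ → ℂ) : partialDiffs ∅ q h h' f = f := rfl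

theorem partialDiffs_congr {s : Finset ι} {q h h' k k' : ι → ℤ} (hk : ∀ i ∈ s, h i = k i)
    (hk' : ∀ i ∈ s, h' i = k' i) (f : ℤ → ℂ) :
    partialDiffs s q h h' f = partialDiffs s q k k' f := by
  unfold partialDiffs
  congr 1
  exact Multiset.map_congr rfl fun i hi => by rw [hk i hi, hk' i hi]

theorem boxDiffs_mul [Fintype ι] (q h h' : ι → ℤ) (f : ℤ → ℂ) :
    boxDiffs (fun i => q i * h i) (fun i => q i * h' i) f = partialDiffs univ q h h' f := rfl

theorem norm_prod_le_one {s : Finset ι} {f : ι → ℂ} (h : ∀ i ∈ s, ‖f i‖ ≤ 1) :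
    ‖∏ i ∈ s, f i‖ ≤ 1 := by
  rw [norm_prod]
  exact prod_le_one (fun _ _ => norm_nonneg _) h

variable [DecidableEq ι]

theorem partialDiffs_insert {s : Finset ι} {i : ι} (hi : i ∉ s) (q h h' : ι → ℤ) (f : ℤ → ℂ) :
    partialDiffs (insert i s) q h h' f =
      boxDiff (q i * h i, q i * h' i) (partialDiffs s q h h' f) := by
  unfold partialDiffs
  rw [insert_val_of_notMem hi, Multiset.map_cons, Multiset.foldr_cons]

theorem partialDiffs_insert_update {s : Finset ι} {i : ι} (hi : i ∉ s) (q h h' : ι → ℤ)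
    (u u' : ℤ) (f : ℤ → ℂ) :
    partialDiffs (insert i s) q (Function.update h i u) (Function.update h' i u') f =
      boxDiff (q i * u, q i * u') (partialDiffs s q h h' f) := by
  rw [partialDiffs_insert hi, Function.update_self, Function.update_self]
  congr 1
  refine partialDiffs_congr (fun j hj => ?_) (fun j hj => ?_) f <;>
  · rw [Function.update_of_ne]
    rintro rfl
    exact hi hj

theorem TransBdd.partialDiffs {S : Finset ℤ} {f : ℤ → ℂ} (hf : TransBdd S f) (s : Finset ι)
    (q h h' : ι → ℤ) : TransBdd S (partialDiffs s q h h' f) := by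
  induction s using Finset.induction_on with
  | empty => exact hf
  | insert i s hi ih => rw [partialDiffs_insert hi]; exact ih.boxDiff _

variable [Fintype ι]

/-- The correlation of a linear system after the factors in `s` have been eliminated. -/
noncomputable def linearCorr (S : Finset ℤ) (m : ℕ) (p : ι → ℤ) (g : ℤ → ℂ) (F : ι → ℤ → ℂ)
    (s : Finset ι) (h h' : ι → ℤ) : ℂ :=
  corr S m fun y x => partialDiffs s p h h' g x *
    ∏ t ∈ sᶜ, partialDiffs s (fun i => p i - p t) h h' (F t) (x - p t * y)

/-- Translating `x` by `p i * y` frees the factor `F i` from `y`, and Cauchy–Schwarz removes it. The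
two shifts then difference `g` along `p i` and each remaining `F t` along `p i - p t`. -/
theorem norm_linearCorr_sq_le {S : Finset ℤ} (hS : S.Nonempty) {m H : ℕ} (hm : 1 ≤ m)
    (hH : 1 ≤ H) (p : ι → ℤ) {g : ℤ → ℂ} (hg : TransBdd S g) {F : ι → ℤ → ℂ}
    (hF : ∀ i, TransBdd S (F i)) {s : Finset ι} {i : ι} (hi : i ∉ s) (h h' : ι → ℤ) :
    ‖linearCorr S m p g F s h h'‖ ^ 2 ≤ 8 * ((H : ℝ) / m) ^ 2 +
      2 * 𝔼 u ∈ Icc (1 : ℤ) H, 𝔼 u' ∈ Icc (1 : ℤ) H,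
        (linearCorr S m p g F (insert i s) (Function.update h i u) (Function.update h' i u')).re := by
  set Φ : ℤ → ℤ → ℂ := fun y x => partialDiffs s p h h' g (x + p i * y) *
    ∏ t ∈ (insert i s)ᶜ, partialDiffs s (fun i => p i - p t) h h' (F t) (x + (p i - p t) * y)
  have hΦ : ∀ y, TransBdd S (Φ y) := fun y =>
    ((hg.partialDiffs s p h h').shift _).mul_of_norm_le fun x =>
      norm_prod_le_one fun t _ => ((hF t).partialDiffs _ _ _ _).1 _
  have hsc : sᶜ = insert i (insert i s)ᶜ := by
    rw [compl_insert, insert_erase (mem_compl.mpr hi)]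
  have e1 : linearCorr S m p g F s h h' =
      corr S m fun y x => partialDiffs s (fun j => p j - p i) h h' (F i) x * Φ y x := by
    unfold linearCorr
    rw [← corr_shift S m _ fun y => p i * y]
    congr 1
    funext y x
    rw [hsc, prod_insert (by simp), add_sub_cancel_right, mul_left_comm]
    congr 2
    refine prod_congr rfl fun t _ => ?_
    congr 1
    ring
  have e2 : ∀ u u', linearCorr S m p g F (insert i s) (Function.update h i u)
      (Function.update h' i u') =
      corr S m fun y x => (starRingEnd ℂ) (Φ (y + u) x) * Φ (y + u') x := by
    intro u u'
    unfold linearCorr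
    rw [← corr_shift S m _ fun y => p i * y]
    congr 1
    funext y x
    rw [partialDiffs_insert_update hi]
    simp_rw [partialDiffs_insert_update hi]
    simp only [boxDiff, prod_mul_distrib, map_mul, map_prod, Φ]
    have c1 : ∀ u, x + p i * y + p i * u = x + p i * (y + u) := fun u => by ring
    have c2 : ∀ t u, x + p i * y - p t * y + (p i - p t) * u = x + (p i - p t) * (y + u) :=
      fun t u => by ring
    simp only [c1, c2]
    ring
  have := norm_corr_mul_sq_le hS hm hH ((hF i).partialDiffs s (fun j => p j - p i) h h') hΦ
  rw [e1]
  simp_rw [e2]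
  simpa only [re_expect] using this

/-- The average of the modulus of `linearCorr`. -/
noncomputable def avgLinearCorr (S : Finset ℤ) (m H : ℕ) (p : ι → ℤ) (g : ℤ → ℂ)
    (F : ι → ℤ → ℂ) (s : Finset ι) : ℝ :=
  𝔼 h ∈ Fintype.piFinset (fun _ : ι => Icc (1 : ℤ) H),
    𝔼 h' ∈ Fintype.piFinset (fun _ : ι => Icc (1 : ℤ) H), ‖linearCorr S m p g F s h h'‖

theorem expect_update_two {I : Finset ℤ} (hI : I.Nonempty) (i : ι) (G : (ι → ℤ) → (ι → ℤ) → ℝ) :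
    𝔼 h ∈ Fintype.piFinset (fun _ : ι => I), 𝔼 h' ∈ Fintype.piFinset (fun _ : ι => I),
      𝔼 u ∈ I, 𝔼 u' ∈ I, G (Function.update h i u) (Function.update h' i u') =
    𝔼 h ∈ Fintype.piFinset (fun _ : ι => I), 𝔼 h' ∈ Fintype.piFinset (fun _ : ι => I), G h h' := by
  rw [← expect_update hI i fun h => 𝔼 h' ∈ Fintype.piFinset (fun _ : ι => I), G h h']
  refine expect_congr rfl fun h _ => ?_
  rw [expect_comm]
  exact expect_congr rfl fun u _ => expect_update hI i fun h' => G (Function.update h i u) h'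

theorem avgLinearCorr_sq_le {S : Finset ℤ} (hS : S.Nonempty) {m H : ℕ} (hm : 1 ≤ m)
    (hH : 1 ≤ H) (p : ι → ℤ) {g : ℤ → ℂ} (hg : TransBdd S g) {F : ι → ℤ → ℂ}
    (hF : ∀ i, TransBdd S (F i)) {s : Finset ι} {i : ι} (hi : i ∉ s) :
    avgLinearCorr S m H p g F s ^ 2 ≤ 8 * ((H : ℝ) / m) ^ 2 +
      2 * 𝔼 h ∈ Fintype.piFinset (fun _ : ι => Icc (1 : ℤ) H),
        𝔼 h' ∈ Fintype.piFinset (fun _ : ι => Icc (1 : ℤ) H),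
          (linearCorr S m p g F (insert i s) h h').re := by
  have hI : (Icc (1 : ℤ) H).Nonempty := ⟨1, by simp; exact_mod_cast hH⟩
  have hne : (Fintype.piFinset (fun _ : ι => Icc (1 : ℤ) H)).Nonempty :=
    Fintype.piFinset_nonempty.mpr fun _ => hI
  rw [← expect_update_two hI i fun h h' => (linearCorr S m p g F (insert i s) h h').re]
  unfold avgLinearCorr
  calc _ ≤ 𝔼 h ∈ Fintype.piFinset (fun _ : ι => Icc (1 : ℤ) H),
        𝔼 h' ∈ Fintype.piFinset (fun _ : ι => Icc (1 : ℤ) H), ‖linearCorr S m p g F s h h'‖ ^ 2 :=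
        (expect_sq_le _ _).trans (expect_le_expect fun _ _ => expect_sq_le _ _)
    _ ≤ _ := (expect_le_expect fun h _ => expect_le_expect fun h' _ =>
        norm_linearCorr_sq_le hS hm hH p hg hF hi h h').trans_eq (by
          simp_rw [expect_add_distrib, expect_const hne, mul_expect])

theorem controls_avgLinearCorr {S : Finset ℤ} {m : ℕ} {X : ℝ} (h : Admissible S m X)
    (p : ι → ℤ) {g : ℤ → ℂ} (hg : TransBdd S g) {F : ι → ℤ → ℂ} (hF : ∀ i, TransBdd S (F i))
    (s : Finset ι) :
    Controls (⌊X⌋₊ / m) s.card ‖corr S m fun y x => g x * ∏ t, F t (x - p t * y)‖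
      (avgLinearCorr S m ⌊X⌋₊ p g F s) := by
  have hI : (Icc (1 : ℤ) ⌊X⌋₊).Nonempty := 
    ⟨1, mem_Icc.mpr ⟨le_rfl, by exact_mod_cast h.one_le_floor⟩⟩
  have hne : (Fintype.piFinset (fun _ : ι => Icc (1 : ℤ) ⌊X⌋₊)).Nonempty :=
    Fintype.piFinset_nonempty.mpr fun _ => hI
  induction s using Finset.induction_on with
  | empty =>
    have : avgLinearCorr S m ⌊X⌋₊ p g F ∅ =
        ‖corr S m fun y x => g x * ∏ t, F t (x - p t * y)‖ := by
      unfold avgLinearCorr linearCorr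
      simp only [partialDiffs_empty, compl_empty, expect_const hne]
    rw [this]
    exact Controls.refl _ _
  | insert i s hi ih =>
    rw [card_insert_of_notMem hi]
    refine ih.trans (Controls.of_sq_le ?_) (norm_nonneg _) h.ratio_nonneg h.ratio_le_one
    refine (avgLinearCorr_sq_le h.nonempty h.one_le_nat h.one_le_floor p hg hF hi).trans ?_
    have h1 : ((⌊X⌋₊ : ℝ) / m) ^ 2 ≤ (⌊X⌋₊ : ℝ) / m :=
      pow_le_of_le_one h.ratio_nonneg h.ratio_le_one two_ne_zero
    have h2 : 𝔼 h ∈ Fintype.piFinset (fun _ : ι => Icc (1 : ℤ) ⌊X⌋₊),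
        𝔼 h' ∈ Fintype.piFinset (fun _ : ι => Icc (1 : ℤ) ⌊X⌋₊),
          (linearCorr S m p g F (insert i s) h h').re ≤
        avgLinearCorr S m ⌊X⌋₊ p g F (insert i s) :=
      expect_le_expect fun _ _ => expect_le_expect fun _ _ => Complex.re_le_norm _
    have h3 : 0 ≤ avgLinearCorr S m ⌊X⌋₊ p g F (insert i s) :=
      expect_nonneg fun _ _ => expect_nonneg fun _ _ => norm_nonneg _
    linarith [h.ratio_nonneg]

/-! ### Box norms along dilated intervals -/

/-- A dilate is a set of values, so `h ↦ p i * h` may collapse the interval when `p i = 0`. The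
averages still agree because all fibres have the same size: `|I|` for each vanishing `p i`, and `1`
otherwise. -/
theorem expect_piFinset_dilate {E : Type*} [Field E] [CharZero E] {X : ℝ} (hX : 1 ≤ X)
    (p : ι → ℤ) (G : (ι → ℤ) → E) :
    𝔼 h ∈ Fintype.piFinset (fun i => dilate (p i) X), G h =
      𝔼 h ∈ Fintype.piFinset (fun _ : ι => interval X), G fun i => p i * h i := by
  set I := interval X with hI
  have hI1 : (1 : ℤ) ∈ I := mem_interval.mpr ⟨le_rfl, by simpa using hX⟩
  set A := Fintype.piFinset (fun _ : ι => I)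
  set B := Fintype.piFinset (fun i => dilate (p i) X)
  set c : ℕ := ∏ i, if p i = 0 then I.card else 1
  have hc : c ≠ 0 := prod_ne_zero_iff.mpr fun i _ => by
    split_ifs
    · exact (card_pos.mpr ⟨1, hI1⟩).ne'
    · exact one_ne_zero
  have hmaps : ∀ h ∈ A, (fun i => p i * h i) ∈ B := fun h hh =>
    Fintype.mem_piFinset.mpr fun i => mem_image_of_mem _ (Fintype.mem_piFinset.mp hh i)
  have hfib : ∀ k ∈ B, (A.filter fun h => (fun i => p i * h i) = k).card = c := by
    intro k hk
    have : (A.filter fun h => (fun i => p i * h i) = k) =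
        Fintype.piFinset fun i => I.filter fun u => p i * u = k i := by
      ext h
      simp only [A, mem_filter, Fintype.mem_piFinset, funext_iff, forall_and]
    rw [this, Fintype.card_piFinset]
    refine prod_congr rfl fun i _ => ?_
    obtain ⟨u, hu, e⟩ := mem_image.mp (Fintype.mem_piFinset.mp hk i)
    split_ifs with hp
    · rw [filter_true_of_mem]
      intro v _
      rw [← e, hp, zero_mul, zero_mul]
    · rw [card_eq_one]
      refine ⟨u, ?_⟩
      ext v
      rw [mem_filter, mem_singleton, ← e]
      constructor
      · exact fun h => mul_left_cancel₀ hp h.2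
      · rintro rfl
        exact ⟨hu, rfl⟩
  have key : ∀ G : (ι → ℤ) → E, ∑ h ∈ A, G (fun i => p i * h i) = c * ∑ k ∈ B, G k := by
    intro G
    rw [← sum_fiberwise_of_maps_to hmaps, mul_sum]
    refine sum_congr rfl fun k hk => ?_
    rw [← hfib k hk, ← nsmul_eq_mul, ← sum_const]
    exact sum_congr rfl fun h hh => by rw [(mem_filter.mp hh).2]
  have hcard : (A.card : E) = c * B.card := by
    simpa using key fun _ => 1
  have hc' : (c : E) ≠ 0 := by exact_mod_cast hc
  rw [expect_eq_sum_div_card, expect_eq_sum_div_card, key, hcard, mul_div_mul_left _ _ hc']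

theorem interval_eq_Icc {X : ℝ} (hX : 1 ≤ X) : interval X = Icc (1 : ℤ) ⌊X⌋₊ := by
  rw [interval, Int.natCast_floor_eq_floor (by linarith)]

theorem tsum_expect {κ : Type*} (s : Finset κ) {f : κ → ℤ → ℂ} (hf : ∀ i ∈ s, Summable (f i)) :
    ∑' x, 𝔼 i ∈ s, f i x = 𝔼 i ∈ s, ∑' x, f i x := by
  simp only [expect_eq_sum_div_card]
  rw [tsum_div_const, Summable.tsum_finsetSum hf]

theorem summable_expect {κ : Type*} (s : Finset κ) {f : κ → ℤ → ℂ}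
    (hf : ∀ i ∈ s, Summable (f i)) : Summable fun x => 𝔼 i ∈ s, f i x := by
  simp only [expect_eq_sum_div_card]
  exact (summable_sum hf).div_const _

theorem boxNormPow_dilate {S : Finset ℤ} {X : ℝ} (hX : 1 ≤ X) (p : ι → ℤ) {g : ℤ → ℂ}
    (hg : TransBdd S g) :
    boxNormPow (fun i => dilate (p i) X) S g =
      𝔼 h ∈ Fintype.piFinset (fun _ : ι => Icc (1 : ℤ) ⌊X⌋₊),
        𝔼 h' ∈ Fintype.piFinset (fun _ : ι => Icc (1 : ℤ) ⌊X⌋₊),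
          (∑' x, partialDiffs univ p h h' g x) / S.card := by
  unfold boxNormPow
  simp_rw [expect_piFinset_dilate hX p, boxDiffs_mul, interval_eq_Icc hX]
  have hs : ∀ h h' : ι → ℤ, Summable fun x => partialDiffs univ p h h' g x := fun h h' =>
    (hg.partialDiffs univ p h h').summable
  rw [tsum_expect _ fun h _ => summable_expect _ fun h' _ => hs h h', mul_expect]
  refine expect_congr rfl fun h _ => ?_
  rw [tsum_expect _ fun h' _ => hs h h', mul_expect]
  exact expect_congr rfl fun h' _ => by ring

theorem norm_expect_le {κ : Type*} {s : Finset κ} {f : κ → ℂ} (h : ∀ i ∈ s, ‖f i‖ ≤ 1) :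
    ‖𝔼 i ∈ s, f i‖ ≤ 1 := by
  rw [expect_eq_sum_div_card, norm_div, Complex.norm_natCast]
  refine div_le_one_of_le₀ ((norm_sum_le_of_le s h).trans ?_) (Nat.cast_nonneg _)
  simp

/-- The power is at most `1`, so taking its root can only increase it. -/
theorem norm_boxNormPow_le_boxNorm {S : Finset ℤ} {X : ℝ} (hX : 1 ≤ X) (p : ι → ℤ) {g : ℤ → ℂ}
    (hg : TransBdd S g) :
    ‖boxNormPow (fun i => dilate (p i) X) S g‖ ≤ boxNorm (fun i => dilate (p i) X) S g := by
  have h1 : ‖boxNormPow (fun i => dilate (p i) X) S g‖ ≤ 1 := by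
    rw [boxNormPow_dilate hX p hg]
    refine norm_expect_le fun h _ => norm_expect_le fun h' _ => ?_
    rw [norm_div, Complex.norm_natCast]
    exact div_le_one_of_le₀ (hg.partialDiffs univ p h h').norm_tsum_le (Nat.cast_nonneg _)
  unfold boxNorm
  have h2 : 1 / (2 : ℝ) ^ Fintype.card ι ≤ 1 :=
    div_le_one_of_le₀ (one_le_pow₀ one_le_two) (by positivity)
  conv_lhs => rw [← Real.rpow_one ‖boxNormPow (fun i => dilate (p i) X) S g‖]
  exact Real.rpow_le_rpow_of_exponent_ge' (norm_nonneg _) h1 (by positivity) h2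

/-- The last factor is removed separately: for the final step the real part is retained, so the
average over `h, h'` can be taken inside and gives the real part of the box norm power. No factor
then depends on `y`, and the sum over `y` cancels against `m`. -/
theorem controls_boxNormPow [Nonempty ι] {S : Finset ℤ} {m : ℕ} {X : ℝ} (h : Admissible S m X)
    (p : ι → ℤ) {g : ℤ → ℂ} (hg : TransBdd S g) {F : ι → ℤ → ℂ} (hF : ∀ i, TransBdd S (F i)) :
    Controls (⌊X⌋₊ / m) (Fintype.card ι) ‖corr S m fun y x => g x * ∏ t, F t (x - p t * y)‖
      ‖boxNormPow (fun i => dilate (p i) X) S g‖ := by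
  obtain ⟨i⟩ := ‹Nonempty ι›
  have hi : i ∉ univ.erase i := notMem_erase i univ
  have h1 := controls_avgLinearCorr h p hg hF (univ.erase i)
  have hcard : (univ.erase i).card + 1 = Fintype.card ι := by
    rw [card_erase_add_one (mem_univ i), card_univ]
  rw [← hcard]
  refine h1.trans (Controls.of_sq_le ?_) (norm_nonneg _) h.ratio_nonneg h.ratio_le_one
  refine (avgLinearCorr_sq_le h.nonempty h.one_le_nat h.one_le_floor p hg hF hi).trans ?_
  have hη : ((⌊X⌋₊ : ℝ) / m) ^ 2 ≤ (⌊X⌋₊ : ℝ) / m :=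
    pow_le_of_le_one h.ratio_nonneg h.ratio_le_one two_ne_zero
  have hm : (m : ℂ) ≠ 0 := by exact_mod_cast (Nat.one_le_iff_ne_zero.mp h.one_le_nat)
  have h2 : 𝔼 a ∈ Fintype.piFinset (fun _ : ι => Icc (1 : ℤ) ⌊X⌋₊),
      𝔼 a' ∈ Fintype.piFinset (fun _ : ι => Icc (1 : ℤ) ⌊X⌋₊),
        (linearCorr S m p g F (insert i (univ.erase i)) a a').re =
      (boxNormPow (fun i => dilate (p i) X) S g).re := by
    rw [boxNormPow_dilate h.one_le p hg]
    simp_rw [re_expect]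
    refine expect_congr rfl fun a _ => expect_congr rfl fun a' _ => ?_
    congr 1
    rw [insert_erase (mem_univ i)]
    unfold linearCorr corr
    simp only [compl_univ, prod_empty, mul_one, sum_const, nsmul_eq_mul]
    rw [Int.card_Icc, mul_comm (S.card : ℂ)]
    simp only [add_sub_cancel_right, Int.toNat_natCast]
    exact mul_div_mul_left _ _ hm
  rw [h2]
  have h3 := Complex.re_le_norm (boxNormPow (fun i => dilate (p i) X) S g)
  linarith [h.ratio_nonneg, norm_nonneg (boxNormPow (fun i => dilate (p i) X) S g)]

end

/-! ### The linear system after the last round, and the initial system -/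

section

variable {S : Finset ℤ}

theorem indexSet_nonempty {ℓ : ℕ} (hℓ : 1 ≤ ℓ) (j : ℕ) :
    (indexSet (levelSteps ℓ) j).Nonempty := by
  induction j with
  | zero => exact ⟨(), mem_singleton_self _⟩
  | succ j ih =>
    obtain ⟨i, hi⟩ := ih
    let ω : Idx (j + 1) := ({⟨i, 1⟩} : Finset ((_ : Idx j) × ℕ))
    refine ⟨ω, mem_indexSet_succ.mpr ⟨singleton_ne_empty _, ?_⟩⟩
    refine singleton_subset_iff.mpr (mem_sigma.mpr ⟨hi, mem_Icc.mpr ⟨le_rfl, ?_⟩⟩)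
    exact one_le_levelSteps hℓ j i

theorem eval_eq_of_coeff {p : Polynomial ℤ} (hp : ∀ n, 2 ≤ n → p.coeff n = 0) (y : ℤ) :
    p.eval y = p.coeff 1 * y + p.coeff 0 := by
  have : p = Polynomial.C (p.coeff 1) * Polynomial.X + Polynomial.C (p.coeff 0) := by
    refine Polynomial.eq_X_add_C_of_natDegree_le_one ?_
    exact Polynomial.natDegree_le_iff_coeff_eq_zero.mpr fun n hn => hp n hn
  conv_lhs => rw [this]
  simp

theorem IsRound.controls {m : ℕ} {X : ℝ} (h : Admissible S m X) {ℓ : ℕ} (hℓ : 1 ≤ ℓ) {c : ℤ}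
    {s : Factor S (varSet (levelSteps ℓ) ℓ)}
    {C : Idx (ℓ - 1) → List (Factor S (varSet (levelSteps ℓ) ℓ))} (hR : IsRound ℓ (ℓ - 1) c s C)
    (a : varSet (levelSteps ℓ) ℓ → ℤ) :
    Controls (⌊X⌋₊ / m) (indexSet (levelSteps ℓ) (ℓ - 1)).card ‖systemCorr m (roundSystem s C) a‖
      ‖boxNormPow (fun i : indexSet (levelSteps ℓ) (ℓ - 1) =>
        dilate (evalAt (varSet (levelSteps ℓ) ℓ) a (dirPoly ℓ c (ℓ - 1) i)) X) S s.fn‖ := by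
  have hD : ℓ - (ℓ - 1) = 1 := by omega
  -- If `ℓ = 1` no round takes place, and the initial class has `ℓ = 1` member.
  have hsize : initialSize ℓ (ℓ - 1) = 1 := by
    unfold initialSize
    split_ifs <;> omega
  have ht : ∀ i : indexSet (levelSteps ℓ) (ℓ - 1), ∃ t, C i = [t] := fun i =>
    List.length_eq_one_iff.mp ((hR.length i i.2).trans hsize)
  choose t ht using ht
  set p : indexSet (levelSteps ℓ) (ℓ - 1) → ℤ := fun i =>
    evalAt (varSet (levelSteps ℓ) ℓ) a (dirPoly ℓ c (ℓ - 1) i) with hp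
  have hmem : ∀ i, t i ∈ roundSystem s C := fun i =>
    List.mem_append_left _ (List.mem_flatten.mpr
      ⟨C i, List.mem_map_of_mem (mem_toList.mpr i.2), by simp [ht i]⟩)
  have hsm : s ∈ roundSystem s C := List.mem_append_right _ (by simp)
  -- Relative to `s` the polynomials are affine with slope `-p i`; the constant terms become
  -- translations of the functions.
  have hev : ∀ i y, (t i |>.poly a).eval y =
      (s.poly a).eval y - p i * y - (s.poly a - (t i).poly a).coeff 0 := by
    intro i y
    have e := eval_eq_of_coeff (p := s.poly a - (t i).poly a) (fun n hn =>
      hR.near_all s hsm (t i) (hmem i) a n (by omega)) y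
    have e1 : (s.poly a - (t i).poly a).coeff 1 = p i := by
      have := hR.gap i i.2 s (by simp) (t i) (by simp [ht i]) a
      rwa [hD] at this
    rw [e1, Polynomial.eval_sub] at e
    linarith
  have : Nonempty (indexSet (levelSteps ℓ) (ℓ - 1)) := (indexSet_nonempty hℓ _).to_subtype
  have key := controls_boxNormPow h p s.transBdd
    (F := fun i x => (t i).fn (x + -(s.poly a - (t i).poly a).coeff 0))
    (fun i => (t i).transBdd.shift _)
  have e : systemCorr m (roundSystem s C) a = corr S m fun y x => s.fn x *
      ∏ i, (t i).fn (x - p i * y + -(s.poly a - (t i).poly a).coeff 0) := by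
    rw [← corr_shift S m _ fun y => (s.poly a).eval y]
    unfold systemCorr
    congr 1
    funext y x
    rw [roundSystem, List.map_append, List.prod_append, mul_comm, List.map_flatten,
      List.prod_flatten, List.map_map, List.map_map, prod_map_toList, ← prod_coe_sort]
    congr 1
    · simp
    · refine prod_congr rfl fun i _ => ?_
      simp only [Function.comp_apply, ht i, List.map_cons, List.map_nil, List.prod_singleton]
      rw [hev]
      congr 1
      ring
  rw [Fintype.card_coe, ← e] at key
  exact key

theorem roundSystem_zero {ℓ : ℕ} (s : Factor S (varSet (levelSteps ℓ) ℓ))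
    (L : List (Factor S (varSet (levelSteps ℓ) ℓ))) :
    roundSystem (j := 0) s (fun _ => L) = L ++ [s] := by
  have : (indexSet (levelSteps ℓ) 0).toList = [()] := toList_singleton ()
  rw [roundSystem, this]
  change [L].flatten ++ [s] = L ++ [s]
  rw [List.flatten_singleton]

/-- The initial system: the last factor is distinguished, the others form one class. -/
theorem isRound_zero {ℓ : ℕ} (hℓ : 1 ≤ ℓ) (t : ℕ → Factor S (varSet (levelSteps ℓ) ℓ))
    (Q : ℕ → Polynomial ℤ) (hQ : ∀ i a, (t i).poly a = Q i)
    (hdeg : ∀ i ≤ ℓ, (Q i).natDegree = i) :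
    IsRound (j := 0) ℓ (Q ℓ).leadingCoeff (t ℓ) fun _ => (List.range ℓ).map t := by
  have hmem : ∀ s ∈ roundSystem (j := 0) (t ℓ) fun _ => (List.range ℓ).map t,
      ∃ i ≤ ℓ, s = t i := by
    intro s hs
    simp only [roundSystem_zero, List.mem_append, List.mem_map, List.mem_range,
      List.mem_singleton] at hs
    rcases hs with ⟨i, hi, rfl⟩ | rfl
    · exact ⟨i, hi.le, rfl⟩
    · exact ⟨ℓ, le_rfl, rfl⟩
  have hcoeff : ∀ i ≤ ℓ, ∀ n, i < n → (Q i).coeff n = 0 := fun i hi n hn =>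
    Polynomial.coeff_eq_zero_of_natDegree_lt (by rw [hdeg i hi]; exact hn)
  refine ⟨fun i _ => by simp [initialSize], fun i _ => ?_, ?_, fun i _ => ?_, ?_⟩
  · intro s hs s' hs' a n hn
    obtain ⟨i, hi, rfl⟩ := List.mem_map.mp hs
    obtain ⟨i', hi', rfl⟩ := List.mem_map.mp hs'
    rw [List.mem_range] at hi hi'
    rw [hQ, hQ, Polynomial.coeff_sub, hcoeff i hi.le n (by omega), hcoeff i' hi'.le n (by omega),
      sub_zero]
  · intro s hs s' hs' a n hn
    obtain ⟨i, hi, rfl⟩ := hmem s hs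
    obtain ⟨i', hi', rfl⟩ := hmem s' hs'
    rw [hQ, hQ, Polynomial.coeff_sub, hcoeff i hi n (by omega), hcoeff i' hi' n (by omega),
      sub_zero]
  · intro s hs s' hs' a
    obtain ⟨i, hi, rfl⟩ := List.mem_map.mp hs'
    rw [List.mem_range] at hi
    rw [List.mem_singleton] at hs
    rw [hs, hQ, hQ, Polynomial.coeff_sub, Nat.sub_zero, hcoeff i hi.le ℓ hi, sub_zero]
    simp [dirPoly, evalAt, Polynomial.leadingCoeff, hdeg ℓ le_rfl]
  · intro s hs v _ a u
    obtain ⟨i, hi, rfl⟩ := hmem s hs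
    rw [hQ, hQ]

theorem prod_Icc_one {M : Type*} [CommMonoid M] (F : ℕ → M) (ℓ : ℕ) :
    F 0 * ∏ i ∈ Icc 1 ℓ, F i = (∏ i ∈ range ℓ, F i) * F ℓ := by
  rw [← prod_range_succ, prod_range_succ', mul_comm]
  congr 1
  have : Icc 1 ℓ = Ico 1 (ℓ + 1) := by ext; simp
  rw [this, prod_Ico_eq_prod_range]
  exact prod_congr rfl fun i _ => by rw [add_comm]

/-- The summands agree; only the normalisations differ, and `|[N]| ⌊M⌋ ≤ N M`. -/
theorem norm_multiAverage_le {ℓ : ℕ} {N M : ℝ} (hN : 0 < N) (hM : 1 ≤ M)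
    (hS : (interval N).Nonempty) {P Q : ℕ → Polynomial ℤ} (hQ0 : Q 0 = 0)
    (hQ : ∀ i, 1 ≤ i → i ≤ ℓ → Q i = P i)
    {f : ℕ → ℤ → ℂ} (t : ℕ → Factor (interval N) (varSet (levelSteps ℓ) ℓ))
    (hft : ∀ i ≤ ℓ, (t i).fn = f i) (ht : ∀ i a, (t i).poly a = Q i)
    (a : varSet (levelSteps ℓ) ℓ → ℤ) :
    ‖multiAverage ℓ N M P f‖ ≤ ‖systemCorr ⌊M⌋₊
      (roundSystem (j := 0) (t ℓ) fun _ => (List.range ℓ).map t) a‖ := by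
  have e1 : ∀ x y, f 0 x * ∏ i ∈ Icc 1 ℓ, f i (x + (P i).eval y) =
      (((roundSystem (j := 0) (t ℓ) fun _ => (List.range ℓ).map t)).map
        fun t => t.fn (x + (t.poly a).eval y)).prod := by
    intro x y
    have h1 : f 0 x * ∏ i ∈ Icc 1 ℓ, f i (x + (P i).eval y) =
        (t 0).fn (x + ((t 0).poly a).eval y) *
          ∏ i ∈ Icc 1 ℓ, (t i).fn (x + ((t i).poly a).eval y) := by
      rw [hft 0 (Nat.zero_le _), ht, hQ0, Polynomial.eval_zero, add_zero]
      congr 1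
      refine prod_congr rfl fun i hi => ?_
      rw [mem_Icc] at hi
      rw [hft i hi.2, ht, hQ i hi.1 hi.2]
    rw [h1, prod_Icc_one (fun i => (t i).fn (x + ((t i).poly a).eval y))]
    rw [roundSystem_zero, List.map_append, List.prod_append, List.map_map]
    simp only [List.map_cons, List.map_nil, List.prod_singleton]
    congr 1
  have e2 : ∑' x, ∑ y ∈ interval M, f 0 x * ∏ i ∈ Icc 1 ℓ, f i (x + (P i).eval y) =
      ∑ y ∈ Icc (1 : ℤ) ⌊M⌋₊, ∑' x, f 0 x * ∏ i ∈ Icc 1 ℓ, f i (x + (P i).eval y) := by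
    rw [interval_eq_Icc hM, Summable.tsum_finsetSum]
    intro y _
    refine (TransBdd.mul_of_norm_le (S := interval N) (hft 0 (Nat.zero_le _) ▸ (t 0).transBdd)
      fun x => norm_prod_le_one fun i hi => ?_).summable
    rw [mem_Icc] at hi
    rw [← hft i hi.2]
    exact (t i).norm_le _
  have hcard : ((interval N).card : ℝ) ≤ N := by
    obtain ⟨n, hn⟩ := hS
    have hn := mem_interval.mp hn
    have hN1 : 1 ≤ N := by
      have : (1 : ℝ) ≤ n := by exact_mod_cast hn.1
      linarith
    rw [interval_eq_Icc hN1, Int.card_Icc]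
    simpa using Nat.floor_le hN.le
  have hm : (⌊M⌋₊ : ℝ) ≤ M := Nat.floor_le (by linarith)
  have hS' : (0 : ℝ) < (interval N).card := by exact_mod_cast hS.card_pos
  have hm' : (0 : ℝ) < ⌊M⌋₊ := by exact_mod_cast (Nat.one_le_floor_iff M).mpr hM
  unfold multiAverage systemCorr corr
  simp_rw [← e1]
  rw [e2, norm_mul, norm_div, norm_div, norm_mul, norm_mul, norm_one, Complex.norm_natCast,
    Complex.norm_natCast, Complex.norm_real, Complex.norm_real, Real.norm_of_nonneg hN.le,
    Real.norm_of_nonneg (by linarith), one_div_mul_eq_div]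
  gcongr

end

/-- The lower bound for the average of the box norms at a fixed scale. -/
theorem averageBoxNorm_ge {S : Finset ℤ} {m : ℕ} {X : ℝ} (h : Admissible S m X) {ℓ : ℕ}
    (hℓ : 1 ≤ ℓ) {c : ℤ} {s : Factor S (varSet (levelSteps ℓ) ℓ)}
    {C : Idx 0 → List (Factor S (varSet (levelSteps ℓ) ℓ))} (hR : IsRound ℓ 0 c s C) {δ : ℝ}
    (hδ : 0 ≤ δ) (hcorr : ∀ a, δ ≤ ‖systemCorr m (roundSystem s C) a‖) :
    (δ / 18) ^ 2 ^ (totalSteps ℓ (ℓ - 1) + (indexSet (levelSteps ℓ) (ℓ - 1)).card) ≤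
      (𝔼 a ∈ Fintype.piFinset (fun _ : varSet (levelSteps ℓ) ℓ => symmInterval X),
        boxNorm (fun i : indexSet (levelSteps ℓ) (ℓ - 1) =>
          dilate (evalAt (varSet (levelSteps ℓ) ℓ) a (dirPoly ℓ c (ℓ - 1) i)) X) S s.fn
      + ⌊X⌋₊ / m) / 18 := by
  obtain ⟨s', C', hs', hR', hc⟩ := hR.iterate h le_rfl
  have hne : (Fintype.piFinset
      (fun _ : varSet (levelSteps ℓ) ℓ => symmInterval X)).Nonempty :=
    Fintype.piFinset_nonempty.mpr fun _ => symmInterval_nonempty h.one_le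
  set n := (indexSet (levelSteps ℓ) (ℓ - 1)).card
  set A := Fintype.piFinset (fun _ : varSet (levelSteps ℓ) ℓ => symmInterval X)
  set β : (varSet (levelSteps ℓ) ℓ → ℤ) → ℝ := fun a =>
    boxNorm (fun i : indexSet (levelSteps ℓ) (ℓ - 1) =>
      dilate (evalAt (varSet (levelSteps ℓ) ℓ) a (dirPoly ℓ c (ℓ - 1) i)) X) S s.fn with hβ
  set η : ℝ := ⌊X⌋₊ / m with hη
  have hη0 : 0 ≤ η := h.ratio_nonneg
  have hη1 : η ≤ 1 := h.ratio_le_one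
  have hβ0 : ∀ a, 0 ≤ β a := fun a => Real.rpow_nonneg (norm_nonneg _) _
  have hE0 : 0 ≤ 𝔼 a ∈ A, β a := expect_nonneg fun a _ => hβ0 a
  have h1 : δ ≤ avgCorr m X (roundSystem s C) := by
    unfold avgCorr
    rw [← expect_const hne δ]
    exact expect_le_expect fun a _ => hcorr a
  have h2 : (δ / 18) ^ 2 ^ totalSteps ℓ (ℓ - 1) ≤
      max (avgCorr m X (roundSystem s' C') / 18) (η / 18) :=
    (pow_le_pow_left₀ (by positivity) (by linarith) _).trans hc
  -- The passage to box norms is made for each `a` separately, so convexity first moves the power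
  -- inside the average; the maximum is then bounded by a sum.
  have h3 : (avgCorr m X (roundSystem s' C') / 18) ^ 2 ^ n ≤ (𝔼 a ∈ A, β a + η) / 18 := by
    have e : avgCorr m X (roundSystem s' C') / 18 =
        𝔼 a ∈ A, ‖systemCorr m (roundSystem s' C') a‖ / 18 := by
      unfold avgCorr
      rw [expect_div]
    have e' : (𝔼 a ∈ A, β a + η) / 18 = 𝔼 a ∈ A, (β a + η) / 18 := by
      rw [← expect_div, expect_add_distrib, expect_const hne]
    rw [e, e']
    refine (expect_pow_two_pow_le _ _ (fun a => by positivity) n).trans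
      (expect_le_expect fun a _ => le_trans (hR'.controls h hℓ a) ?_)
    have h4 := norm_boxNormPow_le_boxNorm h.one_le
      (fun i : indexSet (levelSteps ℓ) (ℓ - 1) =>
        evalAt (varSet (levelSteps ℓ) ℓ) a (dirPoly ℓ c (ℓ - 1) i)) s'.transBdd
    rw [hs'] at h4 ⊢
    refine max_le ?_ ?_
    · exact div_le_div_of_nonneg_right (by linarith [h4]) (by norm_num)
    · exact div_le_div_of_nonneg_right (by linarith [hβ0 a]) (by norm_num)
  rw [pow_add, pow_mul]
  refine (pow_le_pow_left₀ (by positivity) h2 _).trans ?_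
  rcases le_total (avgCorr m X (roundSystem s' C') / 18) (η / 18) with hle | hle
  · rw [max_eq_right hle]
    refine (pow_le_of_le_one (by positivity) (by linarith) (by positivity)).trans ?_
    exact div_le_div_of_nonneg_right (by linarith) (by norm_num)
  · rw [max_eq_left hle]
    exact h3

end PolyBox

/-! ### The choice of the constants -/

open PolyBox

theorem proposition3p4 (ℓ : ℕ) (hℓ : 1 ≤ ℓ) :
    -- the bound `K` for the `k_i` and the exponents `B₁`, `B₂` depend only on `ℓ`
    ∃ K B₁ B₂ : ℕ, ∀ C : ℝ, 0 < C →
      -- the implied constants depend only on `C` and `ℓ`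
      ∃ c₁ c₂ : ℝ, 0 < c₁ ∧ 0 < c₂ ∧
        ∀ (N M : ℝ) (q : ℕ) (P : ℕ → Polynomial ℤ), 0 < N → 0 < M → 1 ≤ q →
          (∀ i : ℕ, 1 ≤ i → i ≤ ℓ → (P i).natDegree = i ∧ HasCoefficients C q (P i)) →
          ∃ k : (j : ℕ) → Idx j → ℕ,
            (∀ j : ℕ, j + 2 ≤ ℓ → ∀ i ∈ indexSet k j, 1 ≤ k j i ∧ k j i ≤ K) ∧
            (1 / C ≤ (q : ℝ) ^ (ℓ - 1) * M ^ ℓ / N → (q : ℝ) ^ (ℓ - 1) * M ^ ℓ / N ≤ C →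
              ∀ f : ℕ → ℤ → ℂ,
                (∀ i : ℕ, i ≤ ℓ → (∀ x, ‖f i x‖ ≤ 1) ∧ ∀ x, x ∉ interval N → f i x = 0) →
                ∀ δ : ℝ, 0 < δ → δ ≤ ‖multiAverage ℓ N M P f‖ →
                  ∀ δ' : ℝ, 0 < δ' → δ' ≤ c₁ * δ ^ B₁ → 1 ≤ δ' * M →
                    c₂ * δ ^ B₂ ≤
                      averageBoxNorm ℓ (P ℓ).leadingCoeff k N (δ' * M) (f ℓ)) := by
  classical
  set k := levelSteps ℓ with hk
  set e := totalSteps ℓ (ℓ - 1) + (indexSet (levelSteps ℓ) (ℓ - 1)).card with he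
  -- `K` is the sum of all `k_i`; the exponent `2 ^ e` comes from `e` applications of Cauchy–Schwarz
  -- in all.
  refine ⟨∑ j ∈ Finset.range ℓ, ∑ i ∈ indexSet k j, k j i, 2 ^ e, 2 ^ e, fun C _ =>
    ⟨1 / 18 ^ 2 ^ e, 1 / 18 ^ 2 ^ e, by positivity, by positivity, ?_⟩⟩
  intro N M q P hN hM _ hP
  refine ⟨k, fun j hj i hi => ⟨one_le_levelSteps hℓ j i, ?_⟩, ?_⟩
  · refine (Finset.single_le_sum (f := k j) (fun _ _ => Nat.zero_le _) hi).trans ?_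
    exact Finset.single_le_sum (f := fun j => ∑ i ∈ indexSet k j, k j i)
      (fun _ _ => Nat.zero_le _) (Finset.mem_range.mpr (by omega))
  intro _ _ f hf δ hδ hΛ δ' hδ' hδδ' hX
  -- The lower bound by `δ > 0` excludes the degenerate cases where `[N]` or `[M]` is empty.
  have hne : multiAverage ℓ N M P f ≠ 0 := fun h => by rw [h, norm_zero] at hΛ; linarith
  have hS : (interval N).Nonempty := by
    rw [Finset.nonempty_iff_ne_empty]
    intro h
    refine hne ?_
    have : ∀ x, f 0 x = 0 := fun x => (hf 0 (Nat.zero_le _)).2 x (by simp [h])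
    simp [multiAverage, this]
  have hM1 : 1 ≤ M := by
    by_contra hlt
    refine hne ?_
    have : interval M = ∅ := by
      rw [Finset.eq_empty_iff_forall_notMem]
      intro y hy
      obtain ⟨h1, h2⟩ := mem_interval.mp hy
      have : (1 : ℝ) ≤ y := by exact_mod_cast h1
      linarith
    simp [multiAverage, this]
  -- The factor `f 0` is evaluated at `x` itself, so it receives the zero polynomial, whatever `P 0`
  -- is.
  set Q : ℕ → Polynomial ℤ := fun i => if i = 0 then 0 else P i with hQdef
  set t : ℕ → Factor (interval N) (varSet (levelSteps ℓ) ℓ) := fun i =>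
    { fn := fun x => if i ≤ ℓ then f i x else 0
      poly := fun _ => Q i
      norm_le := fun x => by
        split_ifs with h
        · exact (hf i h).1 x
        · simp
      eq_zero := fun x hx => by
        split_ifs with h
        · exact (hf i h).2 x hx
        · rfl } with htdef
  have hft : ∀ i ≤ ℓ, (t i).fn = f i := fun i hi => by
    funext x
    simp [htdef, hi]
  have hQℓ : Q ℓ = P ℓ := by simp [hQdef, Nat.one_le_iff_ne_zero.mp hℓ]
  have hR := isRound_zero hℓ t Q (fun _ _ => rfl) (fun i hi => by
    rcases Nat.eq_zero_or_pos i with rfl | h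
    · simp [hQdef]
    · simpa [hQdef, h.ne'] using (hP i h hi).1)
  have hcorr : ∀ a, δ ≤ ‖systemCorr ⌊M⌋₊
      (roundSystem (j := 0) (t ℓ) fun _ => (List.range ℓ).map t) a‖ := fun a =>
    hΛ.trans (norm_multiAverage_le hN hM1 hS (Q := Q) (by simp [hQdef])
      (fun i h _ => by simp [hQdef, Nat.one_le_iff_ne_zero.mp h]) t hft (fun _ _ => rfl) a)
  -- The correlation is trivially at most `1`; this yields `δ' ≤ 1` and hence `⌊δ'M⌋ ≤ ⌊M⌋`.
  have hδ1 : δ ≤ 1 := (hcorr 0).trans (norm_corr_le_one fun y =>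
    transBdd_prod (by simp [roundSystem_zero]) _)
  have hδ'1 : δ' ≤ 1 := by
    refine hδδ'.trans (mul_le_one₀ ?_ (by positivity) (pow_le_one₀ hδ.le hδ1))
    exact div_le_one_of_le₀ (one_le_pow₀ (by norm_num)) (by positivity)
  have hadm : Admissible (interval N) ⌊M⌋₊ (δ' * M) :=
    ⟨hS, hX, Nat.floor_le_floor (mul_le_of_le_one_left hM.le hδ'1)⟩
  have key := averageBoxNorm_ge hadm hℓ hR hδ.le hcorr
  rw [hft ℓ le_rfl, hQℓ, ← he] at key
  -- The factor `2` arises from `M < ⌊M⌋ + 1 ≤ 2⌊M⌋`.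
  have hη : (⌊δ' * M⌋₊ : ℝ) / ⌊M⌋₊ ≤ 2 * δ' := by
    have h1 : (1 : ℝ) ≤ ⌊M⌋₊ := by exact_mod_cast (Nat.one_le_floor_iff M).mpr hM1
    have h2 : (⌊δ' * M⌋₊ : ℝ) ≤ δ' * M := Nat.floor_le (by positivity)
    have h3 : M < (⌊M⌋₊ : ℝ) + 1 := Nat.lt_floor_add_one M
    rw [div_le_iff₀ (by linarith)]
    nlinarith
  have hpow : (δ / 18) ^ 2 ^ e = 1 / 18 ^ 2 ^ e * δ ^ 2 ^ e := by
    rw [div_pow]; ring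
  have hpos : 0 ≤ 1 / 18 ^ 2 ^ e * δ ^ 2 ^ e := by positivity
  rw [hpow] at key
  change _ ≤ (averageBoxNorm ℓ (P ℓ).leadingCoeff k N (δ' * M) (f ℓ) + _) / 18 at key
  -- With `D = δ ^ 2 ^ e / 18 ^ 2 ^ e`, the average is at least `18D - 2δ' ≥ 16D`, since `δ' ≤ D`.
  linarith
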